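/- Let $P\subset\mathbb R^d$ be a simple $d$-dimensional polytope with $n=d+2$ facets, defined by an irredundant set $H$ of $n$ halfspaces, and let its edges be oriented by a unique sink orientation (every non-empty face of $P$ has exactly one sink). Identify each vertex $v$ with the set of those $h\in H$ that contain $v$ in their interior. Then there is a partition $H=X\,\dot\cup\,Y$ such that the vertex set becomes $V=\{\{x,y\}: x\in X,\ y\in Y\}$. Fix any such partition. For $v\in V$ let $\Phi(v)=\{h\in H\setminus v : v\to w \text{ for some } w\in V \text{ with } h\in w\}$, call $(|\Phi(v)\cap X|,|\Phi(v)\cap Y|)$ the refined out-degree of $v$, and let $L=1+\lfloor\log_2\min\{|X|-1,|Y|-1\}\rfloor$. For $1\le i\le L$ there is a unique vertex $w^i$ with refined out-degree $(2^{i-1},2^{i-1})$, and there is a unique vertex $w^0$ with refined out-degree $(0,0)$ (the global sink). For $1\le i\le L$ let $W^i$ be the set of vertices that are reachable from $w^i$ by a non-empty directed path, and let $W^0=\{w^0\}$. Let $0\le i\le L-1$ and $v_0\in W^{i+1}$, and let $v_0,v_1,v_2,\dots$ be the directed random walk that starts in $v_0$: at each step it follows an outgoing edge chosen uniformly at random among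 the outgoing edges of the current vertex, and it rests once it is in a sink. Then the hitting time $T=\min\{k\ge 0: v_k\in W^i\}$ satisfies $$\mathbb E\,T\;\le\;155\,(\mathrm H_n+1),$$ where $\mathrm H_n=\sum_{k=1}^n 1/k$ is the $n$th harmonic number. Moreover $155(\mathrm H_n+1)=O(\log n)$ as $n\to\infty$. -/

import Mathlib

open Set MeasureTheory
open scoped ENNReal

/-- A full-dimensional polytope in `ℝ^d`, given by an irredundant finite system of halfspaces
`⟪normal h, x⟫ ≤ offset h`, `h ∈ H`. As the system is irredundant and the polytope is
full-dimensional, every halfspace defines exactly one facet, and `Fintype.card H` is the number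
of facets. -/
structure HPolytope (d : ℕ) (H : Type*) [Fintype H] where
  normal : H → EuclideanSpace ℝ (Fin d)
  offset : H → ℝ
  isBounded : Bornology.IsBounded {x | ∀ h, inner ℝ (normal h) x ≤ offset h}
  interior_nonempty : (interior {x | ∀ h, inner ℝ (normal h) x ≤ offset h}).Nonempty
  irredundant : ∀ h, ∃ x, (∀ g, g ≠ h → inner ℝ (normal g) x ≤ offset g) ∧
    offset h < inner ℝ (normal h) x

namespace HPolytope

variable {d : ℕ} {H : Type*} [Fintype H]

/-- The point set of the polytope. -/
def carrier (P : HPolytope d H) : Set (EuclideanSpace ℝ (Fin d)) :=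
  {x | ∀ h, inner ℝ (P.normal h) x ≤ P.offset h}

/-- The vertices of the polytope. -/
def Vertex (P : HPolytope d H) : Type :=
  {v : EuclideanSpace ℝ (Fin d) // v ∈ extremePoints ℝ P.carrier}

/-- The non-empty faces of the polytope (the polytope itself included). -/
def IsFace (P : HPolytope d H) (F : Set (EuclideanSpace ℝ (Fin d))) : Prop :=
  F.Nonempty ∧ IsExposed ℝ P.carrier F

/-- The set of those halfspaces that contain the vertex `v` in their interior. -/
def support (P : HPolytope d H) (v : P.Vertex) : Set H :=
  {h | inner ℝ (P.normal h) v.1 < P.offset h}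

/-- A `d`-dimensional polytope is simple if every vertex lies on exactly `d` facets. -/
def IsSimple (P : HPolytope d H) : Prop :=
  ∀ v : P.Vertex, {h | inner ℝ (P.normal h) v.1 = P.offset h}.ncard = d

/-- Two vertices are adjacent if they are the two ends of an edge (a face that is a segment). -/
def Adj (P : HPolytope d H) (u v : P.Vertex) : Prop :=
  u ≠ v ∧ P.IsFace (segment ℝ u.1 v.1)

/-- `H` is the disjoint union of `X` and `Y`, and, when every vertex is identified with its
support, the vertices are exactly the pairs `{x, y}` with `x ∈ X` and `y ∈ Y`. -/
def IsGridPartition (P : HPolytope d H) (X Y : Set H) : Prop :=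
  IsCompl X Y ∧ range P.support = {S | ∃ x ∈ X, ∃ y ∈ Y, S = {x, y}}

/-- An orientation of the edges of the polytope: every edge is directed in exactly one way. -/
structure EdgeOrientation (P : HPolytope d H) where
  arc : P.Vertex → P.Vertex → Prop
  adj_of_arc : ∀ u v, arc u v → P.Adj u v
  xor_of_adj : ∀ u v, P.Adj u v → Xor (arc u v) (arc v u)

namespace EdgeOrientation

variable {P : HPolytope d H}

/-- Every non-empty face has a unique sink. -/
def IsUniqueSink (O : P.EdgeOrientation) : Prop :=
  ∀ F, P.IsFace F → ∃! v : P.Vertex, v.1 ∈ F ∧ ∀ w : P.Vertex, w.1 ∈ F → ¬ O.arc v w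

/-- The outmap `Φ`. -/
def outmap (O : P.EdgeOrientation) (v : P.Vertex) : Set H :=
  {h | h ∉ P.support v ∧ ∃ w, O.arc v w ∧ h ∈ P.support w}

/-- The refined out-degree `(|Φ(v) ∩ X|, |Φ(v) ∩ Y|)`. -/
noncomputable def refinedOutDegree (O : P.EdgeOrientation) (X Y : Set H) (v : P.Vertex) : ℕ × ℕ :=
  ((O.outmap v ∩ X).ncard, (O.outmap v ∩ Y).ncard)

/-- `w` is the vertex `w^i`: it has refined out-degree `(0, 0)` if `i = 0`, and
`(2^(i-1), 2^(i-1))` if `i ≥ 1`. -/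
def IsMilestoneVertex (O : P.EdgeOrientation) (X Y : Set H) : ℕ → P.Vertex → Prop
  | 0, w => O.refinedOutDegree X Y w = (0, 0)
  | i + 1, w => O.refinedOutDegree X Y w = (2 ^ i, 2 ^ i)

/-- The milestone `W^i`, where `w = w^i`: the sink alone if `i = 0`, and the set of vertices that
are reachable from `w` by a non-empty directed path if `i ≥ 1`. -/
def milestone (O : P.EdgeOrientation) : ℕ → P.Vertex → Set P.Vertex
  | 0, w => {w}
  | _ + 1, w => {v | Relation.TransGen O.arc w v}

open Classical in
/-- The transition probabilities of the directed random walk: a uniformly random outgoing edge is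
followed; the walk rests once it is in a sink. -/
noncomputable def stepProb (O : P.EdgeOrientation) (u w : P.Vertex) : ℝ≥0∞ :=
  if ∃ z, O.arc u z then
    if O.arc u w then ({z | O.arc u z}.ncard : ℝ≥0∞)⁻¹ else 0
  else if w = u then 1 else 0

/-- Under the probability measure `μ`, the process `v` is a directed random walk that starts in
the vertex `v₀`. -/
structure IsRandomWalk (O : P.EdgeOrientation) {Ω : Type*} [MeasurableSpace Ω] (μ : Measure Ω)
    (v₀ : P.Vertex) (v : ℕ → Ω → P.Vertex) : Prop where
  isProbabilityMeasure : IsProbabilityMeasure μ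
  measurableSet_eq : ∀ k u, MeasurableSet {ω | v k ω = u}
  start : ∀ᵐ ω ∂μ, v 0 ω = v₀
  step : ∀ (k : ℕ) (u : ℕ → P.Vertex),
    μ {ω | ∀ j ≤ k + 1, v j ω = u j} =
      μ {ω | ∀ j ≤ k, v j ω = u j} * O.stepProb (u k) (u (k + 1))

end EdgeOrientation

end HPolytope

/-- The first time at which the process `v` is in the set `W` (`∞` if there is no such time). -/
noncomputable def walkHittingTime {Ω V : Type*} (v : ℕ → Ω → V) (W : Set V) (ω : Ω) : ℝ≥0∞ :=
  ⨅ (k : ℕ) (_ : v k ω ∈ W), (k : ℝ≥0∞)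

/-- The number `L = 1 + ⌊log₂ (min {|X| - 1, |Y| - 1})⌋` of milestones. -/
noncomputable def numMilestones {H : Type*} (X Y : Set H) : ℕ :=
  1 + Nat.log 2 (min (X.ncard - 1) (Y.ncard - 1))

/-! The slack vectors of the points of $\mathbb R^d$ form an affine plane in $\mathbb R^{d+2}$, cut
out by one homogeneous equation with coefficients $\beta$ and one equation with positive
coefficients. A vertex has exactly two positive slacks, so they sit at one positive and one negative
$\beta$. These signs give $X$ and $Y$; adjacency means sharing a row or a column. Subgrids are
faces, so a unique sink orientation has transitive rows and columns, and no $2\times2$ subgrid with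
two sinks or a directed cycle (`exists_gale`, `exists_isGridPartition`, `exists_gridOrientation`).

Two facts about such grids carry the argument. If $v$ is not reachable from $w$, then $v$ has arcs
to all columns or to all rows that $w$ has arcs to (`hor_or_ver_of_not_transGen`). The grid is also
acyclic (`not_transGen_self`). Hence a vertex reachable from $w$ has a smaller out-degree than $w$
in one direction, and any other vertex $v \ne w$ a larger one. So refined out-degrees are injective,
and by counting every pair in range occurs.

For a phase, let $k$ be the degree of $w^i$ in each direction ($k=1$ for the sink) and let $h$ be a
truncated expected hitting time, with maximum $M$ over the source milestone. Every vertex there has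
one out-degree at most $2k$. A target subgrid $S\times T$ of size $k\times k$ is available, and
every vertex outside the target points to all of $S$ or to all of $T$. If both degrees are at most
$6k$, a step enters a column of $S$ or a row of $T$ with probability at least $1/8$; in such a
column or row $h$ is smaller than $M$ by a multiple of $\mathrm H_n+1$. If one degree is large,
descending in that direction costs only a harmonic number before the walk meets the smaller degrees
(`le_harmonic_of_le_mean`, `descent`). If $M$ exceeded $155(\mathrm H_n+1)$, every value would be
strictly below $M$ (`lt_bound`), which is absurd at a maximum.

Truncation keeps everything finite, and first-step analysis makes each truncated time a subsolution.
Letting the truncation grow bounds $\mathbb E\,T$ (`lintegral_walkHittingTime_le`). -/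

/-! ### Grid orientations: reachability and out-degrees -/

/-- An orientation of the grid `α × β` in which every row and every column is a transitive
tournament, and in which no `2 × 2` subgrid is a directed cycle or has two sinks. -/
structure GridOrientation (α β : Type*) where
  hor : β → α → α → Prop
  ver : α → β → β → Prop
  hor_irrefl : ∀ y x, ¬ hor y x x
  hor_trans : ∀ y x x' x'', hor y x x' → hor y x' x'' → hor y x x''
  hor_total : ∀ y x x', x ≠ x' → hor y x x' ∨ hor y x' x
  ver_irrefl : ∀ x y, ¬ ver x y y
  ver_trans : ∀ x y y' y'', ver x y y' → ver x y' y'' → ver x y y''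
  ver_total : ∀ x y y', y ≠ y' → ver x y y' ∨ ver x y' y
  no_opposite_sinks : ∀ x x' y y',
    hor y x' x → ver x y' y → hor y' x x' → ver x' y y' → False
  no_square_cycle : ∀ x x' y y',
    hor y x x' → ver x' y y' → hor y' x' x → ver x y' y → False

namespace GridOrientation

open Relation

variable {α β : Type*} (G : GridOrientation α β)

/-- The grid with rows and columns exchanged. -/
def flip : GridOrientation β α where
  hor := G.ver
  ver := G.hor
  hor_irrefl := G.ver_irrefl
  hor_trans := G.ver_trans
  hor_total := G.ver_total
  ver_irrefl := G.hor_irrefl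
  ver_trans := G.hor_trans
  ver_total := G.hor_total
  no_opposite_sinks y y' x x' h₁ h₂ h₃ h₄ := G.no_opposite_sinks x x' y y' h₂ h₁ h₄ h₃
  no_square_cycle y z x w h₁ h₂ h₃ h₄ := G.no_square_cycle w x y z h₄ h₁ h₂ h₃

/-- The grid with all arcs reversed. -/
def reverse : GridOrientation α β where
  hor y x x' := G.hor y x' x
  ver x y y' := G.ver x y' y
  hor_irrefl := G.hor_irrefl
  hor_trans y x x' x'' h h' := G.hor_trans y x'' x' x h' h
  hor_total y x x' h := G.hor_total y x' x h.symm
  ver_irrefl := G.ver_irrefl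
  ver_trans x y y' y'' h h' := G.ver_trans x y'' y' y h' h
  ver_total x y y' h := G.ver_total x y' y h.symm
  no_opposite_sinks x x' y y' h₁ h₂ h₃ h₄ := G.no_opposite_sinks x' x y y' h₁ h₄ h₃ h₂
  no_square_cycle x w y z h₁ h₂ h₃ h₄ := G.no_square_cycle w x y z h₁ h₄ h₃ h₂

/-- The arcs of the grid. -/
def Arc (p q : α × β) : Prop :=
  (p.2 = q.2 ∧ G.hor p.2 p.1 q.1) ∨ (p.1 = q.1 ∧ G.ver p.1 p.2 q.2)

variable {G}

lemma hor_asymm {y : β} {x x' : α} (h : G.hor y x x') : ¬ G.hor y x' x :=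
  fun h' => G.hor_irrefl y x (G.hor_trans y x x' x h h')

lemma ver_asymm {x : α} {y y' : β} (h : G.ver x y y') : ¬ G.ver x y' y :=
  fun h' => G.ver_irrefl x y (G.ver_trans x y y' y h h')

lemma arc_hor {y : β} {x x' : α} (h : G.hor y x x') : G.Arc (x, y) (x', y) := Or.inl ⟨rfl, h⟩

lemma arc_ver {x : α} {y y' : β} (h : G.ver x y y') : G.Arc (x, y) (x, y') := Or.inr ⟨rfl, h⟩

lemma arc_flip {p q : α × β} : G.flip.Arc p.swap q.swap ↔ G.Arc p q := or_comm

lemma arc_reverse {p q : α × β} : G.reverse.Arc p q ↔ G.Arc q p := by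
  constructor
  · rintro (⟨h, h'⟩ | ⟨h, h'⟩)
    · exact Or.inl ⟨h.symm, by simpa [reverse, h] using h'⟩
    · exact Or.inr ⟨h.symm, by simpa [reverse, h] using h'⟩
  · rintro (⟨h, h'⟩ | ⟨h, h'⟩)
    · exact Or.inl ⟨h.symm, by simpa [reverse, h] using h'⟩
    · exact Or.inr ⟨h.symm, by simpa [reverse, h] using h'⟩

lemma transGen_flip {p q : α × β} (h : TransGen G.Arc p q) :
    TransGen G.flip.Arc p.swap q.swap :=
  TransGen.lift Prod.swap (fun _ _ h => arc_flip.2 h) _ _ h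

lemma transGen_reverse {p q : α × β} (h : TransGen G.reverse.Arc p q) : TransGen G.Arc q p := by
  induction h with
  | single h => exact .single (arc_reverse.1 h)
  | tail _ h ih => exact .head (arc_reverse.1 h) ih

/-- If `u` is reachable, then so is every vertex `v` that is a sink of the `2 × 2` subgrid spanned
by `u` and `v`. -/
lemma transGen_of_square {w : α × β} {s x : α} {t y : β} (hu : ReflTransGen G.Arc w (s, t))
    (hxs : x ≠ s) (hyt : y ≠ t) (hx : G.hor y s x) (hy : G.ver x t y) :
    TransGen G.Arc w (x, y) := by
  rcases G.hor_total t x s hxs with h | h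
  · rcases G.ver_total s y t hyt with h' | h'
    · exact (G.no_opposite_sinks x s y t hx hy h h').elim
    · exact .tail (.tail' hu (arc_ver h')) (arc_hor hx)
  · exact .tail (.tail' hu (arc_hor h)) (arc_ver hy)

/-- If neither intermediate corner had an arc to `(x, y)`, those two corners would be opposite sinks
of the square. -/
lemma transGen_of_hor_of_ver {w : α × β} {x : α} {y : β} (hx : G.hor w.2 w.1 x)
    (hy : G.ver w.1 w.2 y) : TransGen G.Arc w (x, y) := by
  obtain ⟨s, t⟩ := w
  have hxs : x ≠ s := fun h => G.hor_irrefl t s (by simpa [h] using hx)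
  have hyt : y ≠ t := fun h => G.ver_irrefl s t (by simpa [h] using hy)
  rcases G.hor_total y x s hxs with h | h
  · rcases G.ver_total x y t hyt with h' | h'
    · exact (G.no_opposite_sinks s x y t h hy hx h').elim
    · exact .tail (.single (arc_hor hx)) (arc_ver h')
  · exact .tail (.single (arc_ver hy)) (arc_hor h)

lemma ver_of_not_transGen {w : α × β} {x : α} {y y' : β}
    (hv : ¬ TransGen G.Arc w (x, y)) (h : TransGen G.Arc w (x, y')) : G.ver x y y' := by
  rcases eq_or_ne y y' with rfl | hne
  · exact (hv h).elim
  · exact (G.ver_total x y y' hne).resolve_right fun h' => hv (.tail h (arc_ver h'))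

lemma hor_of_not_transGen {w : α × β} {x x' : α} {y : β}
    (hv : ¬ TransGen G.Arc w (x, y)) (h : TransGen G.Arc w (x', y)) : G.hor y x x' := by
  rcases eq_or_ne x x' with rfl | hne
  · exact (hv h).elim
  · exact (G.hor_total y x x' hne).resolve_right fun hx => hv (.tail h (arc_hor hx))

/-- A vertex that is not reachable from `w` has arcs to all the columns, or to all the rows, that
`w` has arcs to. -/
lemma hor_or_ver_of_not_transGen {w v : α × β} (hv : ¬ TransGen G.Arc w v) :
    (∀ x, G.hor w.2 w.1 x → G.hor v.2 v.1 x) ∨ (∀ y, G.ver w.1 w.2 y → G.ver v.1 v.2 y) := by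
  obtain ⟨x, y⟩ := v
  by_contra! hcon
  obtain ⟨⟨x', hx', hx⟩, ⟨y', hy', hy⟩⟩ := hcon
  -- The corner `(x', y')` is reachable, and the two failing arcs make `v` the sink of the square
  -- that it spans with that corner, hence reachable too.
  have hr := transGen_of_hor_of_ver hx' hy'
  have hxx : x ≠ x' := by rintro rfl; exact hy (ver_of_not_transGen hv hr)
  have hyy : y ≠ y' := by rintro rfl; exact hx (hor_of_not_transGen hv hr)
  exact hv (transGen_of_square hr.to_reflTransGen hxx hyy
    ((G.hor_total y x x' hxx).resolve_left hx) ((G.ver_total x y y' hyy).resolve_left hy))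

section Degrees

set_option linter.unusedSectionVars false

variable [Fintype α] [Fintype β]

variable (G) in
open Classical in
/-- The columns to which `v` has an arc. -/
noncomputable def outX (v : α × β) : Finset α := {x | G.hor v.2 v.1 x}

variable (G) in
open Classical in
/-- The rows to which `v` has an arc. -/
noncomputable def outY (v : α × β) : Finset β := {y | G.ver v.1 v.2 y}

@[simp] lemma mem_outX {v : α × β} {x : α} : x ∈ G.outX v ↔ G.hor v.2 v.1 x := by simp [outX]

@[simp] lemma mem_outY {v : α × β} {y : β} : y ∈ G.outY v ↔ G.ver v.1 v.2 y := by simp [outY]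

lemma outX_ssubset {x x' : α} {y : β} (h : G.hor y x x') : G.outX (x', y) ⊂ G.outX (x, y) := by
  refine Finset.ssubset_iff_subset_ne.2 ⟨fun z hz => ?_, fun he => ?_⟩
  · exact mem_outX.2 (G.hor_trans _ _ _ _ h (mem_outX.1 hz))
  · have : x' ∈ G.outX (x', y) := he ▸ mem_outX.2 h
    exact G.hor_irrefl _ _ (mem_outX.1 this)

lemma outY_ssubset {x : α} {y y' : β} (h : G.ver x y y') : G.outY (x, y') ⊂ G.outY (x, y) :=
  outX_ssubset (G := G.flip) h

/-- If `v` points to the column of `w`, that column is an extra element of `outX v`. Otherwise `v`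
would be reachable unless it pointed to the row of `w` and to all rows that `w` points to, so `outY
v` gains the row of `w`. -/
lemma card_lt_of_hor_of_not_transGen {w v : α × β} (hv : ¬ TransGen G.Arc w v) (hne : v ≠ w)
    (h : ∀ x, G.hor w.2 w.1 x → G.hor v.2 v.1 x) :
    (G.outX w).card < (G.outX v).card ∨ (G.outY w).card < (G.outY v).card := by
  obtain ⟨x, y⟩ := v
  obtain ⟨s, t⟩ := w
  by_cases hs : G.hor y x s
  · left
    refine Finset.card_lt_card (Finset.ssubset_iff_of_subset (fun z hz => ?_) |>.2 ⟨s, ?_, ?_⟩)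
    · exact mem_outX.2 (h z (mem_outX.1 hz))
    · exact mem_outX.2 hs
    · exact fun hz => G.hor_irrefl _ _ (mem_outX.1 hz)
  · right
    have hver : ∀ y', G.ver s t y' ∨ y' = t → G.ver x y y' := by
      intro y' hy'
      have hr : ReflTransGen G.Arc (s, t) (s, y') := by
        rcases hy' with hy' | rfl
        · exact .single (arc_ver hy')
        · exact .refl
      rcases eq_or_ne x s with rfl | hxs
      · rcases eq_or_ne y y' with rfl | hyy
        · rcases hr.cases_head with h | ⟨c, hc, hc'⟩
          · exact (hne h.symm).elim
          · exact (hv (.head' hc hc')).elim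
        · exact (G.ver_total x y y' hyy).resolve_right fun h' => hv (.tail' hr (arc_ver h'))
      · have hsx := (G.hor_total y x s hxs).resolve_left hs
        rcases eq_or_ne y y' with rfl | hyy
        · exact (hv (.tail' hr (arc_hor hsx))).elim
        · exact (G.ver_total x y y' hyy).resolve_right fun h' =>
            hv (transGen_of_square hr hxs hyy hsx h')
    refine Finset.card_lt_card (Finset.ssubset_iff_of_subset (fun z hz => ?_) |>.2 ⟨t, ?_, ?_⟩)
    · exact mem_outY.2 (hver z (.inl (mem_outY.1 hz)))
    · exact mem_outY.2 (hver t (.inr rfl))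
    · exact fun hz => G.ver_irrefl _ _ (mem_outY.1 hz)

/-- A vertex that is not reachable from `w` has a larger out-degree than `w` in one of the two
directions. -/
lemma card_lt_of_not_transGen {w v : α × β} (hv : ¬ TransGen G.Arc w v) (hne : v ≠ w) :
    (G.outX w).card < (G.outX v).card ∨ (G.outY w).card < (G.outY v).card := by
  rcases hor_or_ver_of_not_transGen hv with h | h
  · exact card_lt_of_hor_of_not_transGen hv hne h
  · have := card_lt_of_hor_of_not_transGen (G := G.flip) (w := w.swap) (v := v.swap)
      (fun h' => hv (transGen_flip h')) (fun h' => hne (Prod.swap_injective h')) h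
    exact this.symm

/-- Reversal complements out-degrees, so lower bounds for the reversed grid become upper bounds for
the grid. -/
lemma card_outX_add_card_outX_reverse (v : α × β) :
    (G.outX v).card + (G.reverse.outX v).card + 1 = Fintype.card α := by
  classical
  have hd : Disjoint (G.outX v) (G.reverse.outX v) :=
    Finset.disjoint_left.2 fun x hx hx' => hor_asymm (mem_outX.1 hx) (mem_outX.1 hx')
  have : insert v.1 (G.outX v ∪ G.reverse.outX v) = Finset.univ := by
    ext x
    rcases eq_or_ne v.1 x with h | h
    · simp [h]
    · simpa [h.symm, reverse] using G.hor_total v.2 v.1 x h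
  rw [← Finset.card_union_of_disjoint hd, ← Finset.card_univ, ← this, Finset.card_insert_of_notMem]
  simp [G.hor_irrefl, reverse]

lemma card_outY_add_card_outY_reverse (v : α × β) :
    (G.outY v).card + (G.reverse.outY v).card + 1 = Fintype.card β :=
  card_outX_add_card_outX_reverse (G := G.flip) v.swap

lemma card_outX_lt (v : α × β) : (G.outX v).card < Fintype.card α := by
  have := card_outX_add_card_outX_reverse (G := G) v
  omega

lemma card_outY_lt (v : α × β) : (G.outY v).card < Fintype.card β := by
  have := card_outY_add_card_outY_reverse (G := G) v
  omega

end Degrees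

end GridOrientation

/-! ### Walks and shortest cycles -/

/-- `IsWalk r n p q`: there is a walk of length `n` from `p` to `q`. -/
def IsWalk {V : Type*} (r : V → V → Prop) : ℕ → V → V → Prop
  | 0, p, q => p = q
  | n + 1, p, q => ∃ z, r p z ∧ IsWalk r n z q

namespace IsWalk

variable {V : Type*} {r : V → V → Prop}

lemma trans {m n : ℕ} {p q s : V} (h : IsWalk r m p q) (h' : IsWalk r n q s) :
    IsWalk r (m + n) p s := by
  induction m generalizing p with
  | zero => obtain rfl : p = q := h; simpa using h'
  | succ m ih =>
    obtain ⟨z, hz, hw⟩ := h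
    rw [Nat.add_right_comm]
    exact ⟨z, hz, ih hw⟩

lemma single {p q : V} (h : r p q) : IsWalk r 1 p q := ⟨q, h, rfl⟩

lemma of_transGen {p q : V} (h : Relation.TransGen r p q) : ∃ n, 0 < n ∧ IsWalk r n p q := by
  induction h with
  | single h => exact ⟨1, one_pos, single h⟩
  | tail _ h ih =>
    obtain ⟨n, hn, hw⟩ := ih
    exact ⟨n + 1, n.succ_pos, hw.trans (single h)⟩

lemma exists_seq {n : ℕ} {p q : V} (h : IsWalk r n p q) :
    ∃ f : ℕ → V, f 0 = p ∧ f n = q ∧ ∀ i < n, r (f i) (f (i + 1)) := by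
  induction n generalizing p with
  | zero => exact ⟨fun _ => p, rfl, h, by simp⟩
  | succ n ih =>
    obtain ⟨z, hz, hw⟩ := h
    obtain ⟨f, hf0, hfn, hf⟩ := ih hw
    refine ⟨fun i => i.casesOn p f, rfl, hfn, fun i hi => ?_⟩
    cases i with
    | zero => simpa [hf0] using hz
    | succ i => exact hf i (by omega)

lemma of_seq {f : ℕ → V} (hf : ∀ i, r (f i) (f (i + 1))) (i n : ℕ) :
    IsWalk r n (f i) (f (i + n)) := by
  induction n with
  | zero => rfl
  | succ n ih => exact ih.trans (single (hf _))

/-- A relation with a cycle has a periodic walk none of whose segments has a shortcut. -/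
lemma exists_shortest_cycle {p : V} (h : Relation.TransGen r p p) :
    ∃ n > 0, ∃ f : ℕ → V, (∀ i, f (i + n) = f i) ∧ (∀ i, r (f i) (f (i + 1))) ∧
      ∀ i j l, i ≤ j → j < i + n → IsWalk r l (f i) (f j) → j ≤ i + l := by
  classical
  have hex : ∃ n, 0 < n ∧ ∃ p, IsWalk r n p p := by
    obtain ⟨n, hn, hw⟩ := of_transGen h
    exact ⟨n, hn, p, hw⟩
  obtain ⟨hn, q, hq⟩ := Nat.find_spec hex
  have hmin : ∀ l, 0 < l → (∃ p, IsWalk r l p p) → Nat.find hex ≤ l :=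
    fun l hl hw => Nat.find_min' hex ⟨hl, hw⟩
  generalize Nat.find hex = n at *
  obtain ⟨g, hg0, hgn, hg⟩ := hq.exists_seq
  have hper : ∀ i, g ((i + n) % n) = g (i % n) := fun i => by simp
  have harc : ∀ i, r (g (i % n)) (g ((i + 1) % n)) := by
    intro i
    have hlt := Nat.mod_lt i hn
    rcases Nat.lt_or_ge (i % n + 1) n with h | h
    · have : (i + 1) % n = i % n + 1 := by
        rw [Nat.add_mod_eq_ite, Nat.mod_eq_of_lt (a := 1) (by omega)]
        split_ifs <;> omega
      rw [this]
      exact hg _ hlt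
    · have h0 : (i + 1) % n = 0 := by
        have h1 : i % n + 1 = n := by omega
        rw [← Nat.mod_add_mod, h1, Nat.mod_self]
      have := hg _ hlt
      rw [show i % n + 1 = n by omega, hgn, ← hg0] at this
      rwa [h0]
  refine ⟨n, hn, fun i => g (i % n), hper, harc, fun i j l hij hjn hw => ?_⟩
  have hback := of_seq (r := r) (f := fun i => g (i % n)) harc j (i + n - j)
  rw [show j + (i + n - j) = i + n by omega, hper] at hback
  -- A walk of length `l` from `f i` to `f j`, closed up along the rest of the cycle, is a closed
  -- walk and so has length at least `n`. The bound `j < i + n` makes that length positive.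
  have := hmin _ (by omega) ⟨_, hw.trans hback⟩
  omega

end IsWalk

/-! ### Acyclicity -/

namespace GridOrientation

open Relation

variable {α β : Type*} {G : GridOrientation α β}

lemma not_arc_self (p : α × β) : ¬ G.Arc p p := by
  rintro (⟨_, h⟩ | ⟨_, h⟩)
  · exact G.hor_irrefl _ _ h
  · exact G.ver_irrefl _ _ h

lemma not_arc_symm {p q : α × β} (h : G.Arc p q) : ¬ G.Arc q p := by
  obtain ⟨x, y⟩ := p
  obtain ⟨x', y'⟩ := q
  rintro h'
  simp only [Arc] at h h'
  rcases h with ⟨rfl, h⟩ | ⟨rfl, h⟩ <;> rcases h' with ⟨h₁, h'⟩ | ⟨h₁, h'⟩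
  · exact hor_asymm h h'
  · subst h₁; exact G.hor_irrefl _ _ h
  · subst h₁; exact G.ver_irrefl _ _ h
  · exact ver_asymm h ‹_›

/-- No predicate on pairs has the symmetries that the sink vertices off a shortest cycle of length
`2 * m` would have. -/
lemma false_of_alternating {m : ℕ} (hm : 3 ≤ m) (σ : ℕ → ℕ → Prop)
    (hper : ∀ i d, σ (i + m) d ↔ σ i d)
    (h₁ : ∀ i d, 1 ≤ d → d + 2 ≤ m → (σ i d ↔ ¬ σ (i + d + 1) (m - 1 - d)))
    (h₂ : ∀ i d, 2 ≤ d → d + 2 ≤ m → (σ i d ↔ ¬ σ (i + d) (m - d))) : False := by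
  -- Applying `h₁` twice cancels the negations and shifts `i` by one; `h₁` followed by `h₂` raises
  -- `d` by one. So `σ` is constant in the admissible range, against a single use of `h₁`.
  have hshift : ∀ i d, 1 ≤ d → d + 2 ≤ m → (σ i d ↔ σ (i + 1) d) := by
    intro i d h1 h2
    rw [h₁ i d h1 h2, h₁ (i + d + 1) (m - 1 - d) (by omega) (by omega), not_not,
      show i + d + 1 + (m - 1 - d) + 1 = i + 1 + m by omega,
      show m - 1 - (m - 1 - d) = d by omega, hper]
  have hstep : ∀ d, 1 ≤ d → d + 2 ≤ m → ∀ i, (σ i 1 ↔ σ i d) := by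
    intro d h1
    induction d, h1 using Nat.le_induction with
    | base => exact fun _ _ => Iff.rfl
    | succ d h1 ih =>
      intro h2 i
      rw [ih (by omega) i, h₁ i d h1 (by omega),
        h₂ (i + d + 1) (m - 1 - d) (by omega) (by omega), not_not,
        show i + d + 1 + (m - 1 - d) = i + m by omega, show m - (m - 1 - d) = d + 1 by omega, hper]
  have h := hstep (m - 2) (by omega) (by omega) 1
  rw [h₁ 1 (m - 2) (by omega) (by omega), show 1 + (m - 2) + 1 = 0 + m by omega,
    show m - 1 - (m - 2) = 1 by omega, hper, ← hshift 0 1 le_rfl (by omega)] at h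
  tauto

/-- A shortest cycle cannot exist, in coordinates: the vertices of the cycle are
`(x i, y i)` and `(x (i + 1), y i)`. -/
lemma false_of_staircase {m : ℕ} (hm : 2 ≤ m) (x : ℕ → α) (y : ℕ → β)
    (hxp : ∀ i, x (i + m) = x i) (hyp : ∀ i, y (i + m) = y i)
    (hx : ∀ i, G.hor (y i) (x i) (x (i + 1))) (hy : ∀ i, G.ver (x (i + 1)) (y i) (y (i + 1)))
    (f : ℕ → α × β) (hf₀ : ∀ i, f (2 * i) = (x i, y i))
    (hf₁ : ∀ i, f (2 * i + 1) = (x (i + 1), y i))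
    (hmin : ∀ i j l, i ≤ j → j < i + 2 * m → IsWalk G.Arc l (f i) (f j) → j ≤ i + l) : False := by
  rcases hm.eq_or_lt with rfl | hm
  · have h₁ := hx 1
    have h₂ := hy 1
    rw [show x (1 + 1) = x 0 from hxp 0] at h₁ h₂
    rw [show y (1 + 1) = y 0 from hyp 0] at h₂
    exact G.no_square_cycle _ _ _ _ (hx 0) (hy 0) h₁ h₂
  have hfp : ∀ i, f (2 * i + 2 * m) = f (2 * i) := fun i => by
    rw [← mul_add, hf₀, hf₀, hxp, hyp]
  have hchord : ∀ i j, i < j → j < i + m → ¬ ((x i, y i) = (x j, y j) ∨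
      G.Arc (x i, y i) (x j, y j) ∨ G.Arc (x j, y j) (x i, y i)) := by
    intro i j hij hjm h
    rw [← hf₀, ← hf₀] at h
    rcases h with h | h | h
    · have := hmin (2 * i) (2 * j) 0 (by omega) (by omega) h
      omega
    · have := hmin (2 * i) (2 * j) 1 (by omega) (by omega) (.single h)
      omega
    · rw [← hfp i] at h
      have := hmin (2 * j) (2 * i + 2 * m) 1 (by omega) (by omega) (.single h)
      omega
  -- Two cycle vertices in a common row are joined by an arc, which would shortcut the cycle one way
  -- round or the other. The same holds for columns.
  have hyne : ∀ i j, i < j → j < i + m → y i ≠ y j := by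
    intro i j hij hjm he
    apply hchord i j hij hjm
    rw [he]
    by_cases hne : x i = x j
    · simp [hne]
    · exact .inr ((G.hor_total (y j) _ _ hne).imp arc_hor arc_hor)
  have hxne : ∀ i j, i < j → j < i + m → x i ≠ x j := by
    intro i j hij hjm he
    apply hchord i j hij hjm
    rw [he]
    by_cases hne : y i = y j
    · simp [hne]
    · exact .inr ((G.ver_total (x j) _ _ hne).imp arc_ver arc_ver)
  have hshort : ∀ i j z, i ≤ j → j < i + 2 * m → G.Arc (f i) z → G.Arc z (f j) → j ≤ i + 2 :=
    fun i j z h h' h₁ h₂ => hmin i j 2 h h' (.trans (.single h₁) (.single h₂))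
  -- The off-cycle vertex `(x (i + 1), y (i + 1 + d))` shares its column and its row with two cycle
  -- vertices each. An arc into it and an arc out of it would give a two-step shortcut, so it is a
  -- sink or a source relative to all four; one arc decides which.
  have hsink : ∀ i d, 1 ≤ d → d + 2 ≤ m → G.ver (x (i + 1)) (y i) (y (i + 1 + d)) →
      G.ver (x (i + 1)) (y (i + 1)) (y (i + 1 + d)) ∧
      G.hor (y (i + 1 + d)) (x (i + 1 + d)) (x (i + 1)) ∧
      G.hor (y (i + 1 + d)) (x (i + 1 + d + 1)) (x (i + 1)) := by
    intro i d h1 h2 h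
    have c₀ := arc_ver h
    rw [← hf₁] at c₀
    have r₀ : G.hor (y (i + 1 + d)) (x (i + 1 + d)) (x (i + 1)) := by
      refine (G.hor_total _ _ _ (hxne (i + 1) (i + 1 + d) (by omega) (by omega)).symm).resolve_right
        fun h' => ?_
      have := arc_hor h'
      rw [← hf₀] at this
      have := hshort _ _ _ (by omega) (by omega) c₀ this
      omega
    have r₁ : G.hor (y (i + 1 + d)) (x (i + 1 + d + 1)) (x (i + 1)) := by
      refine (G.hor_total _ _ _
        (hxne (i + 1) (i + 1 + d + 1) (by omega) (by omega)).symm).resolve_right fun h' => ?_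
      have := arc_hor h'
      rw [← hf₁] at this
      have := hshort _ _ _ (by omega) (by omega) c₀ this
      omega
    refine ⟨(G.ver_total _ _ _ (hyne (i + 1) (i + 1 + d) (by omega) (by omega))).resolve_right
      fun h' => ?_, r₀, r₁⟩
    have h₁ := arc_hor r₀
    have h₂ := arc_ver h'
    rw [← hf₀] at h₁
    rw [← hf₀, ← hfp (i + 1)] at h₂
    have := hshort _ _ _ (by omega) (by omega) h₁ h₂
    omega
  have hsource : ∀ i d, 1 ≤ d → d + 2 ≤ m → ¬ G.ver (x (i + 1)) (y i) (y (i + 1 + d)) →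
      G.ver (x (i + 1)) (y (i + 1 + d)) (y i) ∧ G.ver (x (i + 1)) (y (i + 1 + d)) (y (i + 1)) ∧
      G.hor (y (i + 1 + d)) (x (i + 1)) (x (i + 1 + d)) ∧
      G.hor (y (i + 1 + d)) (x (i + 1)) (x (i + 1 + d + 1)) := by
    intro i d h1 h2 h
    have c₀ := (G.ver_total _ _ _ (hyne i (i + 1 + d) (by omega) (by omega))).resolve_left h
    have r₀ : G.hor (y (i + 1 + d)) (x (i + 1)) (x (i + 1 + d)) := by
      refine (G.hor_total _ _ _ (hxne (i + 1) (i + 1 + d) (by omega) (by omega))).resolve_right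
        fun h' => ?_
      have h₁ := arc_hor h'
      have h₂ := arc_ver c₀
      rw [← hf₀] at h₁
      rw [← hf₁] at h₂
      have hp : f (2 * i + 1) = f (2 * (i + m) + 1) := by
        rw [hf₁, hf₁, hyp, show i + m + 1 = i + 1 + m by omega, hxp]
      rw [hp] at h₂
      have := hshort _ _ _ (by omega) (by omega) h₁ h₂
      omega
    have r₁ := G.hor_trans _ _ _ _ r₀ (hx (i + 1 + d))
    refine ⟨c₀, (G.ver_total _ _ _ (hyne (i + 1) (i + 1 + d) (by omega) (by omega))).resolve_left
      fun h' => ?_, r₀, r₁⟩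
    have h₁ := arc_ver h'
    have h₂ := arc_hor r₁
    rw [← hf₀] at h₁
    rw [← hf₁] at h₂
    have := hshort _ _ _ (by omega) (by omega) h₁ h₂
    omega
  -- Both rules come from squares with two opposite corners on the cycle and the other two off it.
  -- If both off-cycle corners were sinks, or both sources, the square would have two opposite
  -- sinks.
  refine false_of_alternating hm (fun i d => G.ver (x (i + 1)) (y i) (y (i + 1 + d))) ?_ ?_ ?_
  · intro i d
    simp only [show i + m + 1 = i + 1 + m by omega, show i + 1 + m + d = i + 1 + d + m by omega,
      hxp, hyp]
  · intro i d h1 h2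
    have e₁ : i + 1 + d + 1 + (m - 1 - d) = i + 1 + m := by omega
    have hs := hsink (i + d + 1) (m - 1 - d) (by omega) (by omega)
    have ht := hsource (i + d + 1) (m - 1 - d) (by omega) (by omega)
    simp only [show i + d + 1 = i + 1 + d by omega, e₁, hyp, hxp] at hs ht ⊢
    constructor
    · intro h h'
      obtain ⟨c, r, r'⟩ := hsink i d h1 h2 h
      exact G.no_opposite_sinks _ _ _ _ r' c (hs h').2.1 h'
    · intro h'
      by_contra h
      obtain ⟨c, c', r, r'⟩ := hsource i d h1 h2 h
      exact G.no_opposite_sinks _ _ _ _ (ht h').2.2.1 c' r' (ht h').1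
  · intro i d h1 h2
    have e₁ : i + 1 + d + (m - d) = i + 1 + m := by omega
    have hs := hsink (i + d) (m - d) (by omega) (by omega)
    have ht := hsource (i + d) (m - d) (by omega) (by omega)
    simp only [show i + d + 1 = i + 1 + d by omega, e₁, hyp, hxp] at hs ht ⊢
    constructor
    · intro h h'
      obtain ⟨c, r, r'⟩ := hsink i d (by omega) h2 h
      exact G.no_opposite_sinks _ _ _ _ r c (hs h').2.1 (hs h').1
    · intro h'
      by_contra h
      obtain ⟨-, c, r, -⟩ := hsource i d (by omega) h2 h
      obtain ⟨-, c₁, r₁, -⟩ := ht h'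
      exact G.no_opposite_sinks _ _ _ _ r₁ c r c₁

/-- The grid orientation is acyclic. -/
theorem not_transGen_self (p : α × β) : ¬ TransGen G.Arc p p := by
  intro hp
  obtain ⟨n, hn, f, hper, harc, hmin⟩ := IsWalk.exists_shortest_cycle hp
  have hn3 : 3 ≤ n := by
    by_contra! h
    have h0 := harc 0
    have hp0 := hper 0
    interval_cases n
    · rw [hp0] at h0
      exact not_arc_self _ h0
    · have h1 := harc 1
      rw [show f (1 + 1) = f 0 from hp0] at h1
      exact not_arc_symm h0 h1
  -- No chord spans two steps, so by transitivity horizontal and vertical arcs alternate.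
  have hchord : ∀ i, ¬ G.Arc (f i) (f (i + 2)) := fun i h => by
    have := hmin i (i + 2) 1 (by omega) (by omega) (.single h)
    omega
  have hH : ∀ i, ((f i).2 = (f (i + 1)).2 ∧ G.hor (f i).2 (f i).1 (f (i + 1)).1) →
      ((f (i + 1)).1 = (f (i + 2)).1 ∧ G.ver (f (i + 1)).1 (f (i + 1)).2 (f (i + 2)).2) := by
    rintro i ⟨h, h'⟩
    refine (harc (i + 1)).resolve_left fun ⟨h₁, h₂⟩ => hchord i (.inl ⟨h.trans h₁, ?_⟩)
    rw [← h] at h₂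
    exact G.hor_trans _ _ _ _ h' h₂
  have hV : ∀ i, ((f i).1 = (f (i + 1)).1 ∧ G.ver (f i).1 (f i).2 (f (i + 1)).2) →
      ((f (i + 1)).2 = (f (i + 2)).2 ∧ G.hor (f (i + 1)).2 (f (i + 1)).1 (f (i + 2)).1) := by
    rintro i ⟨h, h'⟩
    refine (harc (i + 1)).resolve_right fun ⟨h₁, h₂⟩ => hchord i (.inr ⟨h.trans h₁, ?_⟩)
    rw [← h] at h₂
    exact G.ver_trans _ _ _ _ h' h₂
  obtain ⟨s, hs⟩ : ∃ s, (f s).2 = (f (s + 1)).2 ∧ G.hor (f s).2 (f s).1 (f (s + 1)).1 := by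
    rcases harc 0 with h | h
    · exact ⟨0, h⟩
    · exact ⟨1, hV 0 h⟩
  have heven : ∀ i, (f (s + 2 * i)).2 = (f (s + 2 * i + 1)).2 ∧
      G.hor (f (s + 2 * i)).2 (f (s + 2 * i)).1 (f (s + 2 * i + 1)).1 := by
    intro i
    induction i with
    | zero => exact hs
    | succ i ih => exact hV _ (hH _ ih)
  have hodd := fun i => hH _ (heven i)
  obtain ⟨m, rfl⟩ : ∃ m, n = 2 * m := by
    rcases Nat.even_or_odd' n with ⟨m, h | h⟩
    · exact ⟨m, h⟩
    -- For odd length, alternation would make the arc at `s` vertical after one full turn.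
    · exfalso
      have h₁ := (hodd m).1
      rw [show s + 2 * m + 1 = s + n by omega, show s + 2 * m + 2 = s + 1 + n by omega, hper,
        hper] at h₁
      have h₂ := hs.2
      rw [← h₁] at h₂
      exact G.hor_irrefl _ _ h₂
  refine false_of_staircase (G := G) (m := m) (by omega) (fun i => (f (s + 2 * i)).1)
    (fun i => (f (s + 2 * i)).2) (fun i => ?_) (fun i => ?_) (fun i => ?_) (fun i => ?_)
    (fun i => f (s + i)) (fun i => rfl) (fun i => ?_) fun i j l hij hj hw => ?_
  · rw [mul_add, ← add_assoc, hper]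
  · rw [mul_add, ← add_assoc, hper]
  · have := (heven i).2
    rwa [(hodd i).1] at this
  · have := (hodd i).2
    rwa [(hodd i).1, ← (heven i).1] at this
  · exact Prod.ext (hodd i).1 (heven i).1.symm
  · have := hmin (s + i) (s + j) l (by omega) (by omega) hw
    omega

/-! ### Refined out-degrees as coordinates -/

section Degrees

variable [Fintype α] [Fintype β]

/-- A vertex that is reachable from `w` has a smaller out-degree than `w` in one of the two
directions. -/
lemma card_lt_of_transGen {w v : α × β} (hv : TransGen G.Arc w v) :
    (G.outX v).card < (G.outX w).card ∨ (G.outY v).card < (G.outY w).card := by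
  have hne : v ≠ w := by rintro rfl; exact not_transGen_self _ hv
  -- By acyclicity `v` is not reachable from `w` in the reversed grid.
  have := card_lt_of_not_transGen (G := G.reverse) (w := w) (v := v)
    (fun h => not_transGen_self _ (hv.trans (transGen_reverse h))) hne
  have h₁ := card_outX_add_card_outX_reverse (G := G) v
  have h₂ := card_outX_add_card_outX_reverse (G := G) w
  have h₃ := card_outY_add_card_outY_reverse (G := G) v
  have h₄ := card_outY_add_card_outY_reverse (G := G) w
  omega

/-- The refined out-degree determines the vertex. -/
lemma degrees_injective {v w : α × β} (hX : (G.outX v).card = (G.outX w).card)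
    (hY : (G.outY v).card = (G.outY w).card) : v = w := by
  by_contra hne
  by_cases h : TransGen G.Arc w v
  · have := card_lt_of_transGen h
    omega
  · have := card_lt_of_not_transGen h hne
    omega

/-- Every pair of numbers in range is the refined out-degree of a vertex. -/
lemma exists_degrees {a b : ℕ} (ha : a < Fintype.card α) (hb : b < Fintype.card β) :
    ∃ v, (G.outX v).card = a ∧ (G.outY v).card = b := by
  let e : α × β → Fin (Fintype.card α) × Fin (Fintype.card β) :=
    fun v => (⟨_, card_outX_lt (G := G) v⟩, ⟨_, card_outY_lt (G := G) v⟩)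
  have he : Function.Injective e := fun v w h => by
    simp only [e, Prod.mk.injEq, Fin.mk.injEq] at h
    exact degrees_injective h.1 h.2
  -- An injection between finite sets of equal size is onto.
  obtain ⟨v, hv⟩ := ((Fintype.bijective_iff_injective_and_card e).2 ⟨he, by simp⟩).2
    (⟨a, ha⟩, ⟨b, hb⟩)
  simp only [e, Prod.mk.injEq, Fin.mk.injEq] at hv
  exact ⟨v, hv⟩

end Degrees

end GridOrientation

/-! ### The harmonic recursion -/

lemma cast_harmonic_succ (n : ℕ) :
    ((harmonic (n + 1) : ℚ) : ℝ) = (harmonic n : ℝ) + ((n : ℝ) + 1)⁻¹ := by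
  rw [harmonic_succ]
  push_cast
  rfl

lemma cast_harmonic_mono : Monotone fun n : ℕ => ((harmonic n : ℚ) : ℝ) :=
  monotone_nat_of_le_succ fun n => by
    rw [cast_harmonic_succ]
    have : (0 : ℝ) ≤ ((n : ℝ) + 1)⁻¹ := by positivity
    linarith

lemma one_le_cast_harmonic {n : ℕ} (hn : 1 ≤ n) : (1 : ℝ) ≤ (harmonic n : ℝ) := by
  simpa using cast_harmonic_mono hn

/-- If `g b` is at most `1` plus the mean of `a ≤ K` copies of `M` and of all `g j`, `j < b`, as
soon as `b > N`, then `g` grows like a harmonic number beyond `N`. -/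
lemma le_harmonic_of_le_mean {g : ℕ → ℝ} {q K N : ℕ} {M : ℝ} (hM : ∀ j < q, g j ≤ M)
    (hg : ∀ b, N < b → b < q → ∃ a : ℕ, a ≤ K ∧
      (a + b) * g b ≤ (a + b) + a * M + ∑ j ∈ Finset.range b, g j) {b : ℕ} (hb : N < b)
    (hbq : b < q) :
    g b ≤ 1 + ((harmonic (K + b) : ℝ) - (harmonic (K + N + 1) : ℝ)) +
      (K * M + ∑ j ∈ Finset.range (N + 1), g j) / (K + N + 1) := by
  set c := (K * M + ∑ j ∈ Finset.range (N + 1), g j) / (K + N + 1) with hc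
  -- Since `g b ≤ M`, the `a` copies of `M` may be padded to `K` copies.
  have key : ∀ b, N < b → b < q → (K + b) * g b ≤ (K + b) + K * M + ∑ j ∈ Finset.range b, g j := by
    intro b hb hbq
    obtain ⟨a, haK, ha⟩ := hg b hb hbq
    have haK' : (a : ℝ) ≤ K := by exact_mod_cast haK
    nlinarith [mul_le_mul_of_nonneg_left (hM b hbq) (sub_nonneg.2 haK')]
  -- The ratio of the left side to `K + b` starts at `c` and increases by at most `1 / (K + b + 1)`
  -- at each step.
  have hsum : ∀ b, N + 1 ≤ b → b ≤ q → K * M + ∑ j ∈ Finset.range b, g j ≤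
      (K + b) * ((harmonic (K + b) : ℝ) - (harmonic (K + N + 1) : ℝ) + c) := by
    intro b hb
    induction b, hb using Nat.le_induction with
    | base =>
      intro _
      rw [← add_assoc, sub_self, zero_add, hc]
      push_cast
      rw [← add_assoc, mul_div_cancel₀]
      positivity
    | succ b hb ih =>
      intro hbq
      have h₁ := ih (by omega)
      have h₂ := key b (by omega) (by omega)
      have hpos : (0 : ℝ) < K + b := by
        have : (1 : ℝ) ≤ b := by exact_mod_cast (by omega : 1 ≤ b)
        positivity
      rw [Finset.sum_range_succ, ← add_assoc K b 1, cast_harmonic_succ]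
      push_cast
      have h₃ : g b ≤ 1 + ((harmonic (K + b) : ℝ) - (harmonic (K + N + 1) : ℝ) + c) := by
        refine le_of_mul_le_mul_left ?_ hpos
        linarith
      have h₄ : ((K : ℝ) + b + 1) * ((K : ℝ) + b + 1)⁻¹ = 1 := mul_inv_cancel₀ (by positivity)
      nlinarith
  have hpos : (0 : ℝ) < K + b := by
    have : (1 : ℝ) ≤ b := by exact_mod_cast (by omega : 1 ≤ b)
    positivity
  refine le_of_mul_le_mul_left ?_ hpos
  have h₁ := hsum b (by omega) hbq.le
  have h₂ := key b hb hbq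
  linarith

/-! ### The time bound for one phase -/

namespace GridOrientation

open Relation

variable {α β : Type*} [Fintype α] [Fintype β]

lemma card_outY_lt_iff {G : GridOrientation α β} {x : α} {y y' : β} :
    (G.outY (x, y')).card < (G.outY (x, y)).card ↔ G.ver x y y' := by
  refine ⟨fun h => ?_, fun h => Finset.card_lt_card (outY_ssubset h)⟩
  have hne : y ≠ y' := by rintro rfl; exact h.false
  exact (G.ver_total x y y' hne).resolve_right fun hy =>
    h.not_gt (Finset.card_lt_card (outY_ssubset hy))

/-- The rows can be listed in the order in which they occur in a given column. -/
lemma exists_column_enumeration (G : GridOrientation α β) (x : α) (y₀ : β) :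
    ∃ e : ℕ → β, (∀ j < Fintype.card β, (G.outY (x, e j)).card = j) ∧
      ∀ y, e (G.outY (x, y)).card = y := by
  let rk : β → Fin (Fintype.card β) := fun y => ⟨_, card_outY_lt (G := G) (x, y)⟩
  have hinj : Function.Injective rk := fun y y' h => by
    simp only [rk, Fin.mk.injEq] at h
    by_contra hne
    rcases G.ver_total x y y' hne with h' | h'
    · exact (card_outY_lt_iff.2 h').ne h.symm
    · exact (card_outY_lt_iff.2 h').ne h
  have hbij := (Fintype.bijective_iff_injective_and_card rk).2 ⟨hinj, by simp⟩
  let r := Equiv.ofBijective rk hbij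
  refine ⟨fun j => if h : j < Fintype.card β then r.symm ⟨j, h⟩ else y₀, fun j hj => ?_,
    fun y => ?_⟩
  · have := congrArg Fin.val (r.apply_symm_apply ⟨j, hj⟩)
    simp only [hj, dite_true]
    exact this
  · simp only [card_outY_lt, dite_true]
    exact r.symm_apply_apply y

lemma sum_outY (G : GridOrientation α β) {x : α} {e : ℕ → β}
    (he : ∀ j < Fintype.card β, (G.outY (x, e j)).card = j)
    (he' : ∀ y, e (G.outY (x, y)).card = y) (φ : β → ℝ) (y : β) :
    ∑ z ∈ G.outY (x, y), φ z = ∑ j ∈ Finset.range (G.outY (x, y)).card, φ (e j) := by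
  refine Finset.sum_nbij' (fun z => (G.outY (x, z)).card) e (fun z hz => ?_) (fun j hj => ?_)
    (fun z _ => he' z) (fun j hj => ?_) (fun z _ => by rw [he'])
  · exact Finset.mem_range.2 (card_outY_lt_iff.2 (mem_outY.1 hz))
  · have hj' := Finset.mem_range.1 hj
    refine mem_outY.2 (card_outY_lt_iff.1 ?_)
    rwa [he j (hj'.trans (card_outY_lt _))]
  · exact he j ((Finset.mem_range.1 hj).trans (card_outY_lt _))

/-- The situation between two milestones: the walk is in the closed set `Z`, its target is the
closed set `W`, which contains the `k × k` subgrid `S × T`, and `h` is a subsolution of the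
equation that the expected hitting time of `W` satisfies. -/
structure IsPhase (G : GridOrientation α β) (k : ℕ) (Z W : Set (α × β)) (S : Finset α)
    (T : Finset β) (h : α × β → ℝ) (M : ℝ) : Prop where
  one_le : 1 ≤ k
  le_card_left : 2 * k ≤ Fintype.card α
  le_card_right : 2 * k ≤ Fintype.card β
  mem_of_arc : ∀ v v', v ∈ Z → G.Arc v v' → v' ∈ Z
  target_of_arc : ∀ v v', v ∈ W → G.Arc v v' → v' ∈ W
  degree_le : ∀ v ∈ Z, (G.outX v).card ≤ 2 * k ∨ (G.outY v).card ≤ 2 * k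
  card_left : S.card = k
  card_right : T.card = k
  subgrid : ∀ x ∈ S, ∀ y ∈ T, (x, y) ∈ W
  subset_or_subset : ∀ v, v ∉ W → S ⊆ G.outX v ∨ T ⊆ G.outY v
  nonneg : ∀ v, 0 ≤ h v
  le_bound : ∀ v ∈ Z, h v ≤ M
  target : ∀ v ∈ W, h v = 0
  le_mean : ∀ v ∈ Z, v ∉ W → ((G.outX v).card + (G.outY v).card) * h v ≤
    ((G.outX v).card + (G.outY v).card) + ∑ x ∈ G.outX v, h (x, v.2) + ∑ y ∈ G.outY v, h (v.1, y)

namespace IsPhase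

variable {G : GridOrientation α β} {k : ℕ} {Z W : Set (α × β)} {S : Finset α}
  {T : Finset β} {h : α × β → ℝ} {M : ℝ}

lemma flip (H : IsPhase G k Z W S T h M) :
    IsPhase G.flip k (Prod.swap ⁻¹' Z) (Prod.swap ⁻¹' W) T S (h ∘ Prod.swap) M where
  one_le := H.one_le
  le_card_left := H.le_card_right
  le_card_right := H.le_card_left
  mem_of_arc v v' hv ha := H.mem_of_arc v.swap v'.swap hv (arc_flip (p := v.swap).1 ha)
  target_of_arc v v' hv ha := H.target_of_arc v.swap v'.swap hv (arc_flip (p := v.swap).1 ha)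
  degree_le v hv := (H.degree_le v.swap hv).symm
  card_left := H.card_right
  card_right := H.card_left
  subgrid y hy x hx := H.subgrid x hx y hy
  subset_or_subset v hv := (H.subset_or_subset v.swap hv).symm
  nonneg v := H.nonneg v.swap
  le_bound v hv := H.le_bound v.swap hv
  target v hv := H.target v.swap hv
  le_mean v hv hv' := by
    have := H.le_mean v.swap hv hv'
    rw [add_comm ((G.outX v.swap).card : ℝ), add_assoc,
      add_comm (∑ x ∈ G.outX v.swap, h (x, v.swap.2)), ← add_assoc] at this
    exact this

lemma bound_nonneg (H : IsPhase G k Z W S T h M) {v : α × β} (hv : v ∈ Z) : 0 ≤ M :=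
  (H.nonneg v).trans (H.le_bound v hv)

lemma mem_hor (H : IsPhase G k Z W S T h M) {v : α × β} (hv : v ∈ Z) {x : α}
    (hx : x ∈ G.outX v) : (x, v.2) ∈ Z :=
  H.mem_of_arc _ _ hv (arc_hor (mem_outX.1 hx))

lemma mem_ver (H : IsPhase G k Z W S T h M) {v : α × β} (hv : v ∈ Z) {y : β}
    (hy : y ∈ G.outY v) : (v.1, y) ∈ Z :=
  H.mem_of_arc _ _ hv (arc_ver (mem_outY.1 hy))

lemma sum_outX_le (H : IsPhase G k Z W S T h M) {v : α × β} (hv : v ∈ Z) :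
    ∑ x ∈ G.outX v, h (x, v.2) ≤ (G.outX v).card * M := by
  simpa using Finset.sum_le_card_nsmul _ _ M fun x hx => H.le_bound _ (H.mem_hor hv hx)

lemma sum_outY_le (H : IsPhase G k Z W S T h M) {v : α × β} (hv : v ∈ Z) :
    ∑ y ∈ G.outY v, h (v.1, y) ≤ (G.outY v).card * M := by
  simpa using Finset.sum_le_card_nsmul _ _ M fun y hy => H.le_bound _ (H.mem_ver hv hy)

/-- The points of `T` in a column of `S` lie in `W`. As `W` is closed under arcs, none of them can
point to a vertex outside `W`. -/
lemma subset_outY (H : IsPhase G k Z W S T h M) {v : α × β} (hv : v ∉ W)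
    (hS : v.1 ∈ S) : T ⊆ G.outY v := by
  intro y hy
  have hw := H.subgrid _ hS _ hy
  have hne : v.2 ≠ y := by rintro rfl; exact hv hw
  exact mem_outY.2 ((G.ver_total _ _ _ hne).resolve_right fun hy =>
    hv (H.target_of_arc _ _ hw (arc_ver hy)))

/-- The descent in a column from a vertex of large vertical out-degree. -/
lemma descent (H : IsPhase G k Z W S T h M) {N : ℕ} (hN : 2 * k ≤ N)
    {v : α × β} (hv : v ∈ Z) (hb : N < (G.outY v).card)
    {e : ℕ → β} (he : ∀ j < Fintype.card β, (G.outY (v.1, e j)).card = j)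
    (he' : ∀ y, e (G.outY (v.1, y)).card = y) :
    h v ≤ (harmonic (Fintype.card α + Fintype.card β) : ℝ) +
      (2 * k * M + ∑ j ∈ Finset.range (N + 1), h (v.1, e j)) / (2 * k + N + 1) := by
  have hlt := card_outY_lt (G := G) v
  have hev : e (G.outY v).card = v.2 := he' v.2
  have hmem : ∀ j < (G.outY v).card + 1, (v.1, e j) ∈ Z := by
    intro j hj
    rcases (Nat.lt_succ_iff.1 hj).eq_or_lt with rfl | hj
    · rw [hev]; exact hv
    · refine H.mem_ver hv (mem_outY.2 (card_outY_lt_iff.1 ?_))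
      rwa [he j (by omega)]
  have key := le_harmonic_of_le_mean (g := fun j => h (v.1, e j)) (q := (G.outY v).card + 1)
    (K := 2 * k) (N := N) (M := M) (fun j hj => H.le_bound _ (hmem j hj)) (fun b hNb hbq => ?_) hb
    (Nat.lt_succ_self _)
  · simp only [hev] at key
    have h₁ := cast_harmonic_mono (show 2 * k + (G.outY v).card ≤
      Fintype.card α + Fintype.card β by have := H.le_card_left; omega)
    -- The subtracted harmonic number is at least one and absorbs the additive `1`.
    have h₂ := one_le_cast_harmonic (show 1 ≤ 2 * k + N + 1 by omega)
    push_cast at key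
    simp only at h₁
    linarith
  · have hz := hmem b hbq
    have hcard := he b (by omega)
    refine ⟨(G.outX (v.1, e b)).card, ?_, ?_⟩
    -- The vertical degree exceeds `N ≥ 2 * k`, so the horizontal one is at most `2 * k`.
    · exact (H.degree_le _ hz).resolve_right (by omega)
    · have hM := H.bound_nonneg hv
      by_cases hw : (v.1, e b) ∈ W
      · simp only [H.target _ hw, mul_zero]
        have : 0 ≤ ∑ j ∈ Finset.range b, h (v.1, e j) := Finset.sum_nonneg fun _ _ => H.nonneg _
        positivity
      · have h₁ := H.le_mean _ hz hw
        have h₂ := H.sum_outX_le hz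
        rw [sum_outY G he he' (fun y => h (v.1, y)), hcard] at h₁
        linarith

/-- The amount by which the time bound improves once the walk is in a column of `S` or in a row
of `T`. -/
noncomputable def gain (α β : Type*) [Fintype α] [Fintype β] : ℝ :=
  18 * ((harmonic (Fintype.card α + Fintype.card β) : ℝ) + 1)

lemma cast_harmonic_nonneg : (0 : ℝ) ≤ (harmonic (Fintype.card α + Fintype.card β) : ℝ) := by
  simpa using cast_harmonic_mono (Nat.zero_le (Fintype.card α + Fintype.card β))


/-- A column of `S` contains many target vertices. A vertex of vertical degree at most `2 * k` hits
the target within one step with probability at least `1/8`. From a higher vertex, descend and use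
that the `k` lowest vertices of the column are all in `W`. -/
lemma le_of_mem_left (H : IsPhase G k Z W S T h M)
    (hM : 155 * ((harmonic (Fintype.card α + Fintype.card β) : ℝ) + 1) < M)
    {v : α × β} (hv : v ∈ Z) (hS : v.1 ∈ S) (ha : (G.outX v).card ≤ 6 * k) :
    h v ≤ M - gain α β := by
  have hL := cast_harmonic_nonneg (α := α) (β := β)
  have hk : (1 : ℝ) ≤ k := by exact_mod_cast H.one_le
  by_cases hw : v ∈ W
  · rw [H.target v hw, gain]
    linarith
  have hT := H.subset_outY hw hS
  rcases Nat.lt_or_ge (2 * k) (G.outY v).card with hb | hb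
  · obtain ⟨e, he, he'⟩ := G.exists_column_enumeration v.1 v.2
    have hd := H.descent le_rfl hv hb he he'
    have hlt := card_outY_lt (G := G) v
    have hsum : ∑ j ∈ Finset.range (2 * k + 1), h (v.1, e j) ≤ (k + 1) * M := by
      rw [show 2 * k + 1 = k + (k + 1) by omega, Finset.sum_range_add]
      -- A vertex of this column outside `W` points to all `k` rows of `T`, so vertical degree below
      -- `k` forces membership in `W`.
      have h₀ : ∑ j ∈ Finset.range k, h (v.1, e j) = 0 := by
        refine Finset.sum_eq_zero fun j hj => H.target _ ?_
        have hj' := Finset.mem_range.1 hj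
        by_contra hn
        have h₁ := Finset.card_le_card (H.subset_outY hn hS)
        rw [he j (by omega), H.card_right] at h₁
        omega
      have h₁ := Finset.sum_le_card_nsmul (Finset.range (k + 1)) (fun j => h (v.1, e (k + j))) M
        fun j hj => by
          have hj' := Finset.mem_range.1 hj
          refine H.le_bound _ (H.mem_ver hv (mem_outY.2 (card_outY_lt_iff.1 ?_)))
          rw [he _ (by omega)]
          change _ < (G.outY v).card
          omega
      simp only [Finset.card_range, nsmul_eq_mul] at h₁
      push_cast at h₁
      linarith
    have hq : (2 * k * M + ∑ j ∈ Finset.range (2 * k + 1), h (v.1, e j)) /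
        (2 * k + (2 * k : ℕ) + 1) ≤ 4 / 5 * M := by
      -- The ratio is at most `(3k + 1) / (4k + 1) ≤ 4/5` for `k ≥ 1`. The remaining `M / 5` exceeds
      -- `31 * (harmonic + 1)`, enough for the harmonic term and the gain.
      rw [div_le_iff₀ (by positivity)]
      push_cast
      have hM0 := H.bound_nonneg hv
      nlinarith
    rw [gain]
    linarith
  · have hmean := H.le_mean v hv hw
    have hX := H.sum_outX_le hv
    have hY : ∑ y ∈ G.outY v, h (v.1, y) ≤ ((G.outY v).card - k) * M := by
      classical
      rw [← Finset.sum_sdiff hT, Finset.sum_eq_zero (s := T)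
        (fun y hy => H.target _ (H.subgrid _ hS _ hy)), add_zero]
      have h₁ := Finset.sum_le_card_nsmul (G.outY v \ T) (fun y => h (v.1, y)) M fun y hy =>
        H.le_bound _ (H.mem_ver hv (Finset.mem_sdiff.1 hy).1)
      rw [Finset.card_sdiff_of_subset hT, H.card_right, nsmul_eq_mul, Nat.cast_sub] at h₁
      · exact h₁
      · rw [← H.card_right]; exact Finset.card_le_card hT
    have hab : ((G.outX v).card : ℝ) + (G.outY v).card ≤ 8 * k := by
      exact_mod_cast (by omega : (G.outX v).card + (G.outY v).card ≤ 8 * k)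
    have hpos : (0 : ℝ) < ((G.outX v).card : ℝ) + (G.outY v).card := by
      have := Finset.card_le_card hT
      rw [H.card_right] at this
      have : (k : ℝ) ≤ (G.outY v).card := by exact_mod_cast this
      linarith [Nat.cast_nonneg (α := ℝ) (G.outX v).card]
    -- The value is at most `1 + 7 * M / 8`, and `M / 8 > 19 * (harmonic + 1) ≥ 1 + gain`. This case
    -- dictates the size of the constant 155.
    refine le_of_mul_le_mul_left ?_ hpos
    rw [gain]
    have hM0 := H.bound_nonneg hv
    nlinarith

/-- At least `k` of at most `8 * k` arcs lead into columns of `S`, where the bound is better by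
`gain`. Horizontal moves do not raise the horizontal degree, so `le_of_mem_left` applies there. -/
lemma le_of_subset_outX (H : IsPhase G k Z W S T h M)
    (hM : 155 * ((harmonic (Fintype.card α + Fintype.card β) : ℝ) + 1) < M)
    {v : α × β} (hv : v ∈ Z) (hw : v ∉ W) (ha : (G.outX v).card ≤ 6 * k)
    (hab : (G.outX v).card + (G.outY v).card ≤ 8 * k) (hS : S ⊆ G.outX v) :
    h v ≤ 1 + M - gain α β / 8 := by
  have hL := cast_harmonic_nonneg (α := α) (β := β)
  have hk : (1 : ℝ) ≤ k := by exact_mod_cast H.one_le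
  have hmean := H.le_mean v hv hw
  have hY := H.sum_outY_le hv
  have hkX : k ≤ (G.outX v).card := by rw [← H.card_left]; exact Finset.card_le_card hS
  have hX : ∑ x ∈ G.outX v, h (x, v.2) ≤ (G.outX v).card * M - k * gain α β := by
    classical
    rw [← Finset.sum_sdiff hS]
    have h₁ := Finset.sum_le_card_nsmul (G.outX v \ S) (fun x => h (x, v.2)) M fun x hx =>
      H.le_bound _ (H.mem_hor hv (Finset.mem_sdiff.1 hx).1)
    have h₂ := Finset.sum_le_card_nsmul S (fun x => h (x, v.2)) (M - gain α β) fun x hx =>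
      H.le_of_mem_left hM (H.mem_hor hv (hS hx)) hx
        ((Finset.card_le_card (outX_ssubset (mem_outX.1 (hS hx))).subset).trans ha)
    rw [Finset.card_sdiff_of_subset hS, H.card_left, nsmul_eq_mul, Nat.cast_sub hkX] at h₁
    rw [H.card_left, nsmul_eq_mul] at h₂
    linarith
  have hab' : ((G.outX v).card : ℝ) + (G.outY v).card ≤ 8 * k := by exact_mod_cast hab
  have hkX' : (k : ℝ) ≤ (G.outX v).card := by exact_mod_cast hkX
  have hpos : (0 : ℝ) < ((G.outX v).card : ℝ) + (G.outY v).card := by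
    linarith [Nat.cast_nonneg (α := ℝ) (G.outY v).card]
  refine le_of_mul_le_mul_left ?_ hpos
  have hg : 0 ≤ gain α β := by rw [gain]; positivity
  nlinarith

/-- One degree is at most `2 * k`, so the total is at most `8 * k`; the case `T ⊆ outY` is the
flipped one. -/
lemma le_of_card_le (H : IsPhase G k Z W S T h M)
    (hM : 155 * ((harmonic (Fintype.card α + Fintype.card β) : ℝ) + 1) < M)
    {v : α × β} (hv : v ∈ Z) (hw : v ∉ W) (ha : (G.outX v).card ≤ 6 * k)
    (hb : (G.outY v).card ≤ 6 * k) : h v ≤ 1 + M - gain α β / 8 := by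
  have hab : (G.outX v).card + (G.outY v).card ≤ 8 * k := by
    have := H.degree_le v hv
    omega
  rcases H.subset_or_subset v hw with hS | hT
  · exact H.le_of_subset_outX hM hv hw ha hab hS
  · have := H.flip.le_of_subset_outX (v := v.swap) (by rwa [add_comm (Fintype.card β)]) hv hw hb
      (by rw [add_comm]; exact hab) hT
    rwa [gain, add_comm (Fintype.card β), ← gain] at this

/-- The descent is stopped at `N = 6 * k`. Of the levels up to there, the `4 * k` above `2 * k` have
both degrees at most `6 * k` and thus an improved bound, which outweighs the harmonic cost. -/
lemma lt_of_card_outY_gt (H : IsPhase G k Z W S T h M)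
    (hM : 155 * ((harmonic (Fintype.card α + Fintype.card β) : ℝ) + 1) < M)
    {v : α × β} (hv : v ∈ Z) (hb : 6 * k < (G.outY v).card) : h v < M := by
  have hL := cast_harmonic_nonneg (α := α) (β := β)
  have hk : (1 : ℝ) ≤ k := by exact_mod_cast H.one_le
  obtain ⟨e, he, he'⟩ := G.exists_column_enumeration v.1 v.2
  have hd := H.descent (by omega) hv hb he he'
  have hlt := card_outY_lt (G := G) v
  have hmem : ∀ j < (G.outY v).card, (v.1, e j) ∈ Z := fun j hj => by
    refine H.mem_ver hv (mem_outY.2 (card_outY_lt_iff.1 ?_))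
    rwa [he j (by omega)]
  have hsum : ∑ j ∈ Finset.range (6 * k + 1), h (v.1, e j) ≤
      (2 * k + 1) * M + 4 * k * (1 + M - gain α β / 8) := by
    rw [show 6 * k + 1 = (2 * k + 1) + 4 * k by omega, Finset.sum_range_add]
    have h₁ := Finset.sum_le_card_nsmul (Finset.range (2 * k + 1)) (fun j => h (v.1, e j)) M
      fun j hj => H.le_bound _ (hmem j (by have := Finset.mem_range.1 hj; omega))
    have h₂ := Finset.sum_le_card_nsmul (Finset.range (4 * k))
      (fun j => h (v.1, e (2 * k + 1 + j))) (1 + M - gain α β / 8) fun j hj => by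
        have hj' := Finset.mem_range.1 hj
        have hz := hmem (2 * k + 1 + j) (by omega)
        by_cases hw : (v.1, e (2 * k + 1 + j)) ∈ W
        · rw [H.target _ hw, gain]
          linarith
        · have hc := he (2 * k + 1 + j) (by omega)
          have := H.degree_le _ hz
          exact H.le_of_card_le hM hz hw (by omega) (by omega)
    simp only [Finset.card_range, nsmul_eq_mul] at h₁ h₂
    push_cast at h₁ h₂
    linarith
  refine hd.trans_lt ?_
  -- The quotient is at most `M - 4k / (8k + 1) * (gain / 8 - 1)`, and `4k / (8k + 1) ≥ 4/9`. The
  -- factor 18 in `gain` is chosen so that `4/9 * 18/8 = 1`; the loss then exceeds the harmonic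
  -- number.
  rw [← lt_sub_iff_add_lt', div_lt_iff₀ (by positivity)]
  push_cast
  rw [gain] at hsum
  nlinarith

lemma lt_bound (H : IsPhase G k Z W S T h M)
    (hM : 155 * ((harmonic (Fintype.card α + Fintype.card β) : ℝ) + 1) < M)
    {v : α × β} (hv : v ∈ Z) : h v < M := by
  have hL := cast_harmonic_nonneg (α := α) (β := β)
  by_cases hw : v ∈ W
  · rw [H.target v hw]
    linarith
  rcases Nat.lt_or_ge (6 * k) (G.outY v).card with hb | hb
  · exact H.lt_of_card_outY_gt hM hv hb
  rcases Nat.lt_or_ge (6 * k) (G.outX v).card with ha | ha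
  · exact H.flip.lt_of_card_outY_gt (v := v.swap) (by rwa [add_comm (Fintype.card β)]) hv ha
  · have := H.le_of_card_le hM hv hw ha hb
    rw [gain] at this
    linarith

/-- The bound on the expected time that a phase takes. -/
theorem le_harmonic (H : IsPhase G k Z W S T h M) {v : α × β} (hv : v ∈ Z) :
    h v ≤ 155 * ((harmonic (Fintype.card α + Fintype.card β) : ℝ) + 1) := by
  -- Take `M` to be the maximum of `h` on `Z`; `lt_bound` at a maximizer is the contradiction.
  obtain ⟨u, hu, hmax⟩ := Z.toFinite.exists_maximalFor h Z ⟨v, hv⟩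
  have hu' : ∀ v ∈ Z, h v ≤ h u := fun v hv => le_of_not_gt fun hlt => hlt.not_ge (hmax hv hlt.le)
  refine (hu' v hv).trans (le_of_not_gt fun hlt => ?_)
  exact (lt_bound { H with le_bound := hu' } hlt hu).false

end IsPhase

end GridOrientation

/-! ### Hitting times of finite Markov chains -/

section HittingTime

variable {V Ω : Type*}

open Classical in
/-- The expectation of the minimum of `t` and the hitting time of `W`, for the Markov chain with
transition probabilities `p`, as a function of the starting point. -/
noncomputable def truncatedHittingTime [Fintype V] (p : V → V → ℝ≥0∞) (W : Set V) :
    ℕ → V → ℝ≥0∞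
  | 0, _ => 0
  | t + 1, u => if u ∈ W then 0 else 1 + ∑ w, p u w * truncatedHittingTime p W t w

lemma truncatedHittingTime_of_mem [Fintype V] {p : V → V → ℝ≥0∞} {W : Set V} {u : V} (hu : u ∈ W)
    (t : ℕ) : truncatedHittingTime p W t u = 0 := by
  cases t <;> simp [truncatedHittingTime, hu]

/-- With the recursion this makes the time truncated at `t` a subsolution of the hitting-time
equation. -/
lemma truncatedHittingTime_le_succ [Fintype V] (p : V → V → ℝ≥0∞) (W : Set V) (t : ℕ) (u : V) :
    truncatedHittingTime p W t u ≤ truncatedHittingTime p W (t + 1) u := by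
  induction t generalizing u with
  | zero => simp [truncatedHittingTime]
  | succ t ih =>
    rw [truncatedHittingTime, truncatedHittingTime]
    split_ifs
    · exact le_rfl
    · gcongr
      exact ih _

lemma truncatedHittingTime_ne_top [Fintype V] {p : V → V → ℝ≥0∞} (hp : ∀ u w, p u w ≠ ∞)
    (W : Set V) (t : ℕ) (u : V) : truncatedHittingTime p W t u ≠ ∞ := by
  induction t generalizing u with
  | zero => simp [truncatedHittingTime]
  | succ t ih =>
    rw [truncatedHittingTime]
    split_ifs
    · simp
    · exact ENNReal.add_ne_top.2 ⟨by simp, ENNReal.sum_ne_top.2 fun w _ =>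
        ENNReal.mul_ne_top (hp _ _) (ih w)⟩

open Classical in
-- The tail-sum formula: the `j`th indicator is that of the event that the hitting time exceeds `j`.
lemma walkHittingTime_le_tsum (v : ℕ → Ω → V) (W : Set V) (ω : Ω) :
    walkHittingTime v W ω ≤
      ∑' j : ℕ, {ω | ∀ i ≤ j, v i ω ∉ W}.indicator (fun _ => (1 : ℝ≥0∞)) ω := by
  by_cases hex : ∃ k, v k ω ∈ W
  · calc walkHittingTime v W ω ≤ (Nat.find hex : ℝ≥0∞) :=
        iInf₂_le (Nat.find hex) (Nat.find_spec hex)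
      _ = ∑ j ∈ Finset.range (Nat.find hex),
          {ω | ∀ i ≤ j, v i ω ∉ W}.indicator (fun _ => (1 : ℝ≥0∞)) ω := by
        rw [Finset.sum_congr rfl fun j hj => indicator_of_mem (?_ : ω ∈ _) _]
        · simp
        · intro i hi
          exact Nat.find_min hex (hi.trans_lt (Finset.mem_range.1 hj))
      _ ≤ _ := ENNReal.sum_le_tsum _
  · push Not at hex
    have : ∀ j : ℕ, {ω | ∀ i ≤ j, v i ω ∉ W}.indicator (fun _ => (1 : ℝ≥0∞)) ω = 1 :=
      fun j => indicator_of_mem (show ω ∈ {ω | ∀ i ≤ j, v i ω ∉ W} from fun i _ => hex i) _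
    simp [this]

variable [Fintype V] [MeasurableSpace Ω] {μ : Measure Ω} {v : ℕ → Ω → V}

lemma measurableSet_preimage_of_fintype (hmeas : ∀ k u, MeasurableSet {ω | v k ω = u}) (k : ℕ)
    (s : Set V) : MeasurableSet {ω | v k ω ∈ s} := by
  have : {ω | v k ω ∈ s} = ⋃ u ∈ s, {ω | v k ω = u} := by ext; simp
  rw [this]
  exact MeasurableSet.biUnion s.to_countable fun u _ => hmeas k u

/-- The Markov property for the event that the walk has avoided `W` so far. -/
lemma measure_avoid_inter_step {p : V → V → ℝ≥0∞}
    (hmeas : ∀ k u, MeasurableSet {ω | v k ω = u})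
    (hstep : ∀ (k : ℕ) (u : ℕ → V), μ {ω | ∀ j ≤ k + 1, v j ω = u j} =
      μ {ω | ∀ j ≤ k, v j ω = u j} * p (u k) (u (k + 1))) (W : Set V) (k : ℕ) (u z : V) :
    μ ({ω | ∀ i ≤ k, v i ω ∉ W} ∩ {ω | v k ω = u} ∩ {ω | v (k + 1) ω = z}) =
      μ ({ω | ∀ i ≤ k, v i ω ∉ W} ∩ {ω | v k ω = u}) * p u z := by
  classical
  let E : (Fin (k + 1) → V) → Set Ω := fun c => {ω | ∀ i : Fin (k + 1), v i ω = c i}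
  have hE : ∀ c, MeasurableSet (E c) := fun c => by
    simp only [E, ofPred_forall]
    exact MeasurableSet.iInter fun i => hmeas _ _
  have hdisj : Pairwise (Function.onFun Disjoint E) := fun c c' hne =>
    Set.disjoint_left.2 fun ω hω hω' => hne (funext fun i => (hω i).symm.trans (hω' i))
  -- The step axiom concerns fully specified histories, so events are split over all of them. Only
  -- those avoiding `W` and ending in `u` contribute.
  have hsum : ∀ B : Set Ω, MeasurableSet B → μ B = ∑ c, μ (E c ∩ B) := by
    intro B hB
    rw [← tsum_fintype (L := .unconditional _), ← measure_iUnion]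
    · congr 1
      ext ω
      simp only [mem_iUnion, mem_inter_iff, exists_and_right, E, mem_ofPred_eq]
      exact ⟨fun h => ⟨⟨fun i => v i ω, fun i => rfl⟩, h⟩, fun h => h.2⟩
    · exact fun c c' hne => (hdisj hne).mono inter_subset_left inter_subset_left
    · exact fun c => (hE c).inter hB
  have hA : MeasurableSet {ω | ∀ i ≤ k, v i ω ∉ W} := by
    simp only [ofPred_forall]
    exact MeasurableSet.iInter fun i => MeasurableSet.iInter fun _ =>
      measurableSet_preimage_of_fintype hmeas i Wᶜ
  have hB := hA.inter (hmeas k u)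
  rw [hsum _ (hB.inter (hmeas (k + 1) z)), hsum _ hB, Finset.sum_mul]
  refine Finset.sum_congr rfl fun c _ => ?_
  by_cases hc : (∀ i, c i ∉ W) ∧ c (Fin.last k) = u
  · let path : ℕ → V := fun i => if h : i < k + 1 then c ⟨i, h⟩ else z
    have hpath : ∀ ω, (∀ j ≤ k, v j ω = path j) ↔ ω ∈ E c := by
      intro ω
      constructor
      · intro h i
        rw [h i (by omega)]
        exact dif_pos i.2
      · intro h j hj
        rw [show path j = c ⟨j, by omega⟩ from dif_pos (by omega)]
        exact h ⟨j, by omega⟩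
    have hlast : path k = u := by simpa [path, Fin.last] using hc.2
    have hnext : path (k + 1) = z := by simp [path]
    have hsub : E c ⊆ {ω | ∀ i ≤ k, v i ω ∉ W} ∩ {ω | v k ω = u} := by
      intro ω hω
      refine ⟨fun i hi => ?_, ?_⟩
      · have := hω ⟨i, by omega⟩
        rw [show v i ω = _ from this]
        exact hc.1 _
      · exact (hω (Fin.last k)).trans hc.2
    have h₁ : {ω | ∀ j ≤ k, v j ω = path j} = E c := Set.ext hpath
    have h₂ : {ω | ∀ j ≤ k + 1, v j ω = path j} = E c ∩ {ω | v (k + 1) ω = z} := by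
      ext ω
      simp only [mem_inter_iff, ← hpath, mem_ofPred_eq, Nat.le_succ_iff, or_imp, forall_and,
        forall_eq, hnext]
    have h₃ := hstep k path
    rw [h₁, h₂, hlast, hnext] at h₃
    rw [← inter_assoc, inter_eq_left.2 hsub, h₃]
  · have : E c ∩ ({ω | ∀ i ≤ k, v i ω ∉ W} ∩ {ω | v k ω = u}) = ∅ := by
      rw [← Set.disjoint_iff_inter_eq_empty, Set.disjoint_left]
      rintro ω hω ⟨h₁, h₂⟩
      refine hc ⟨fun i => ?_, ?_⟩
      · rw [← hω i]
        exact h₁ i (by omega)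
      · rw [← hω (Fin.last k)]
        exact h₂
    rw [← inter_assoc, this]
    simp

/-- The expected hitting time of a Markov chain on a finite set is bounded by the truncated
hitting times. -/
theorem lintegral_walkHittingTime_le {p : V → V → ℝ≥0∞} [IsProbabilityMeasure μ]
    (hmeas : ∀ k u, MeasurableSet {ω | v k ω = u}) {v₀ : V} (hstart : ∀ᵐ ω ∂μ, v 0 ω = v₀)
    (hstep : ∀ (k : ℕ) (u : ℕ → V), μ {ω | ∀ j ≤ k + 1, v j ω = u j} =
      μ {ω | ∀ j ≤ k, v j ω = u j} * p (u k) (u (k + 1))) {W : Set V} {C : ℝ≥0∞}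
    (hC : ∀ t, truncatedHittingTime p W t v₀ ≤ C) :
    ∫⁻ ω, walkHittingTime v W ω ∂μ ≤ C := by
  classical
  let A : ℕ → Set Ω := fun j => {ω | ∀ i ≤ j, v i ω ∉ W}
  have hA : ∀ j, MeasurableSet (A j) := fun j => by
    simp only [A, ofPred_forall]
    exact MeasurableSet.iInter fun i => MeasurableSet.iInter fun _ =>
      measurableSet_preimage_of_fintype hmeas i Wᶜ
  have hsplit : ∀ (k : ℕ) (B : Set Ω), MeasurableSet B →
      μ B = ∑ u, μ (B ∩ {ω | v k ω = u}) := by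
    intro k B hB
    rw [← tsum_fintype (L := .unconditional _), ← measure_iUnion]
    · congr 1; ext; simp
    · exact fun u u' hne => Set.disjoint_left.2 fun ω h h' => hne (h.2.symm.trans h'.2)
    · exact fun u => hB.inter (hmeas k u)
  let Q : ℕ → V → ℝ≥0∞ := fun j u => μ (A j ∩ {ω | v j ω = u})
  have hQ : ∀ j u, u ∉ W → Q (j + 1) u = ∑ u', Q j u' * p u' u := by
    intro j u hu
    have : A (j + 1) ∩ {ω | v (j + 1) ω = u} = A j ∩ {ω | v (j + 1) ω = u} := by
      ext ω
      simp only [A, mem_inter_iff, mem_ofPred_eq, Nat.le_succ_iff, or_imp, forall_and, forall_eq]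
      constructor
      · exact fun h => ⟨h.1.1, h.2⟩
      · exact fun h => ⟨⟨h.1, by rw [h.2]; exact hu⟩, h.2⟩
    simp only [Q]
    rw [this, hsplit j _ ((hA j).inter (hmeas _ _))]
    refine Finset.sum_congr rfl fun u' _ => ?_
    rw [inter_right_comm]
    exact measure_avoid_inter_step hmeas hstep W j u' u
  have hQ₀ : ∀ j u, u ∈ W → Q j u = 0 := by
    intro j u hu
    have : A j ∩ {ω | v j ω = u} = ∅ := by
      rw [← Set.disjoint_iff_inter_eq_empty, Set.disjoint_left]
      intro ω h h'
      exact h j le_rfl (by rw [show v j ω = u from h']; exact hu)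
    simp only [Q, this, measure_empty]
  -- By induction on `t`, for all `s`: the expected number of times in `[s, s + t)` before the
  -- target is hit equals the truncated hitting time averaged over the surviving mass at time `s`.
  have hmass : ∀ t s, ∑ j ∈ Finset.range t, μ (A (s + j)) =
      ∑ u, Q s u * truncatedHittingTime p W t u := by
    intro t
    induction t with
    | zero => simp [truncatedHittingTime]
    | succ t ih =>
      intro s
      have hterm : ∀ z, Q (s + 1) z * truncatedHittingTime p W t z =
          ∑ u, Q s u * (p u z * truncatedHittingTime p W t z) := by
        intro z
        by_cases hz : z ∈ W
        · simp [truncatedHittingTime_of_mem hz]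
        · rw [hQ s z hz, Finset.sum_mul]
          exact Finset.sum_congr rfl fun u _ => mul_assoc _ _ _
      rw [Finset.sum_range_succ', add_zero, hsplit s _ (hA s)]
      rw [Finset.sum_congr rfl fun j _ => by rw [← add_assoc, add_right_comm],
        ih (s + 1), Finset.sum_congr rfl fun z _ => hterm z, Finset.sum_comm,
        ← Finset.sum_add_distrib]
      refine Finset.sum_congr rfl fun u _ => ?_
      change _ + Q s u = _
      by_cases hu : u ∈ W
      · simp [hQ₀ s u hu]
      · simp only [truncatedHittingTime, hu, if_false]
        rw [mul_add, mul_one, Finset.mul_sum, add_comm]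
  have hpart : ∀ t, ∑ j ∈ Finset.range t, μ (A j) ≤ C := by
    intro t
    have h₁ := hmass t 0
    simp only [zero_add] at h₁
    rw [h₁, Finset.sum_eq_single v₀]
    · exact (mul_le_of_le_one_left' prob_le_one).trans (hC t)
    · intro u _ hu
      have : Q 0 u = 0 := by
        refine measure_mono_null (inter_subset_right.trans ?_) hstart
        intro ω (hω : v 0 ω = u) h
        exact hu (hω.symm.trans h)
      rw [this, zero_mul]
    · simp
  calc ∫⁻ ω, walkHittingTime v W ω ∂μ
      ≤ ∫⁻ ω, ∑' j, (A j).indicator (fun _ => (1 : ℝ≥0∞)) ω ∂μ :=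
        lintegral_mono fun ω => walkHittingTime_le_tsum v W ω
    _ = ∑' j, μ (A j) := by
        rw [lintegral_tsum fun j => (measurable_const.indicator (hA j)).aemeasurable]
        exact tsum_congr fun j => by rw [lintegral_indicator_const (hA j), one_mul]
    _ ≤ C := ENNReal.tsum_le_of_sum_range_le hpart

end HittingTime

/-! ### Faces, vertices and edges in terms of slacks -/

namespace HPolytope

variable {d : ℕ} {H : Type*} [Fintype H] (P : HPolytope d H)

/-- The slack of the point `x` in the halfspace `h`. -/
noncomputable def slack (x : EuclideanSpace ℝ (Fin d)) (h : H) : ℝ :=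
  P.offset h - inner ℝ (P.normal h) x

variable {P}

lemma mem_carrier {x : EuclideanSpace ℝ (Fin d)} : x ∈ P.carrier ↔ ∀ h, 0 ≤ P.slack x h := by
  simp [carrier, slack]

lemma mem_support {v : P.Vertex} {h : H} : h ∈ P.support v ↔ 0 < P.slack v.1 h := by
  simp [support, slack]

lemma slack_combo {a b : ℝ} (hab : a + b = 1) (x y : EuclideanSpace ℝ (Fin d)) (h : H) :
    P.slack (a • x + b • y) h = a * P.slack x h + b * P.slack y h := by
  simp only [slack, inner_add_right, inner_smul_right]
  linear_combination P.offset h * (-hab)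

lemma continuous_slack (h : H) : Continuous fun x => P.slack x h := by
  unfold slack
  fun_prop

variable (P) in
lemma carrier_nonempty : P.carrier.Nonempty := P.interior_nonempty.mono interior_subset

variable (P) in
lemma isCompact_carrier : IsCompact P.carrier := by
  refine Metric.isCompact_of_isClosed_isBounded ?_ P.isBounded
  have : P.carrier = ⋂ h, {x | 0 ≤ P.slack x h} := by ext; simp [mem_carrier]
  rw [this]
  exact isClosed_iInter fun h => isClosed_le continuous_const (continuous_slack h)

variable (P) in
lemma convex_carrier : Convex ℝ P.carrier := by
  intro x hx y hy a b ha hb hab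
  rw [mem_carrier] at *
  intro h
  rw [slack_combo hab]
  exact add_nonneg (mul_nonneg ha (hx h)) (mul_nonneg hb (hy h))

/-- As the polytope is bounded, its recession cone is trivial. -/
lemma eq_zero_of_inner_nonpos {x : EuclideanSpace ℝ (Fin d)}
    (hx : ∀ h, inner ℝ (P.normal h) x ≤ 0) : x = 0 := by
  obtain ⟨p, hp⟩ := P.carrier_nonempty
  obtain ⟨R, hR⟩ := P.isBounded.exists_norm_le
  by_contra hne
  have hpos : 0 < ‖x‖ := norm_pos_iff.2 hne
  have hR0 : 0 ≤ R := (norm_nonneg p).trans (hR p hp)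
  set t := (R + ‖p‖ + 1) / ‖x‖ with ht
  have ht0 : 0 ≤ t := by positivity
  have hmem : p + t • x ∈ P.carrier := by
    rw [mem_carrier] at *
    intro h
    have h₁ := hp h
    have h₂ := mul_nonneg ht0 (neg_nonneg.2 (hx h))
    simp only [slack, inner_add_right, inner_smul_right] at *
    linarith
  have h₁ := hR _ hmem
  have h₂ : ‖t • x‖ ≤ ‖p + t • x‖ + ‖p‖ := by
    simpa using norm_sub_le (p + t • x) p
  rw [norm_smul, Real.norm_of_nonneg ht0, ht, div_mul_cancel₀ _ hpos.ne'] at h₂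
  linarith

/-- The difference of the two points lies in the trivial recession cone. -/
lemma eq_of_slack_eq {x y : EuclideanSpace ℝ (Fin d)} (hxy : ∀ h, P.slack x h = P.slack y h) :
    x = y := by
  rw [← sub_eq_zero]
  refine eq_zero_of_inner_nonpos (P := P) fun h => ?_
  have := hxy h
  simp only [slack] at this
  rw [inner_sub_right]
  linarith

/-- From `m` one can go on beyond `m`, coming from a point `q` that is tight wherever `m` is. -/
lemma exists_mem_openSegment {m q : EuclideanSpace ℝ (Fin d)} (hm : m ∈ P.carrier)
    (hmq : ∀ h, P.slack m h = 0 → P.slack q h = 0) :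
    ∃ r ∈ P.carrier, m ∈ openSegment ℝ q r := by
  have hev : ∀ᶠ ε : ℝ in nhdsWithin 0 (Ioi 0), ∀ h, 0 < P.slack m h →
      ε * P.slack q h < P.slack m h := by
    rw [Filter.eventually_all]
    intro h
    by_cases hpos : 0 < P.slack m h
    · have hc : Filter.Tendsto (fun ε : ℝ => ε * P.slack q h) (nhdsWithin 0 (Ioi 0))
          (nhds (0 * P.slack q h)) :=
        ((continuous_id.mul continuous_const).tendsto (0 : ℝ)).mono_left nhdsWithin_le_nhds
      rw [zero_mul] at hc
      filter_upwards [hc.eventually (gt_mem_nhds hpos)] with ε hε _ using hε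
    · exact Filter.Eventually.of_forall fun _ h' => (hpos h').elim
  obtain ⟨ε, hε, hε0⟩ := (hev.and self_mem_nhdsWithin).exists
  have hε0 : 0 < ε := hε0
  refine ⟨(1 + ε) • m + (-ε) • q, ?_, ε / (1 + ε), 1 / (1 + ε), by positivity, by positivity,
    by field_simp; ring, ?_⟩
  · rw [mem_carrier] at *
    intro h
    rw [slack_combo (by ring)]
    rcases (hm h).eq_or_lt with h0 | h0
    · rw [← h0, hmq h h0.symm]
      simp
    · have := hε h h0
      nlinarith
  · rw [smul_add, smul_smul, smul_smul, one_div, inv_mul_cancel₀ (by positivity), one_smul]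
    have : ε / (1 + ε) = -((1 + ε)⁻¹ * -ε) := by ring
    rw [this, neg_smul]
    abel

/-- Coming from `u`, one can continue beyond `v` inside the polytope, so extremality of `v` forces
`u = v`. -/
lemma Vertex.eq_of_support_subset {u v : P.Vertex} (h : P.support u ⊆ P.support v) : u = v := by
  obtain ⟨r, hr, hmem⟩ := exists_mem_openSegment (q := u.1) v.2.1 fun g hg => by
    have hu := mem_carrier.1 u.2.1 g
    by_contra hne
    have := h (mem_support.2 (lt_of_le_of_ne hu (Ne.symm hne)))
    rw [mem_support] at this
    exact this.ne' hg
  exact Subtype.ext ((mem_extremePoints_iff_left.1 v.2).2 _ u.2.1 _ hr hmem)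

lemma support_injective : Function.Injective P.support := fun _ _ h =>
  Vertex.eq_of_support_subset h.subset

instance : Finite P.Vertex := Finite.of_injective _ support_injective

instance : Nonempty P.Vertex :=
  let ⟨v, hv⟩ := P.isCompact_carrier.extremePoints_nonempty P.carrier_nonempty
  ⟨⟨v, hv⟩⟩

variable (P) in
/-- The points of the polytope that are tight outside of `C`. -/
def faceOf (C : Set H) : Set (EuclideanSpace ℝ (Fin d)) :=
  {x ∈ P.carrier | ∀ h ∉ C, P.slack x h = 0}

lemma Vertex.mem_faceOf {v : P.Vertex} {C : Set H} : v.1 ∈ P.faceOf C ↔ P.support v ⊆ C := by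
  constructor
  · intro h g hg
    by_contra hgC
    exact (mem_support.1 hg).ne' (h.2 g hgC)
  · refine fun h => ⟨v.2.1, fun g hg => ?_⟩
    exact ((mem_carrier.1 v.2.1 g).eq_or_lt.resolve_right fun h' => hg (h (mem_support.2 h'))).symm

/-- The sum of the normals outside `C` is maximal exactly where all of those slacks vanish, provided
that this happens somewhere. -/
lemma isExposed_faceOf (C : Set H) : IsExposed ℝ P.carrier (P.faceOf C) := by
  classical
  rintro ⟨z, hz, hzC⟩
  let l : StrongDual ℝ (EuclideanSpace ℝ (Fin d)) := ∑ h with h ∉ C, innerSL ℝ (P.normal h)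
  have hl : ∀ x, l x = ∑ h with h ∉ C, (P.offset h - P.slack x h) := fun x => by
    simp [l, slack]
  refine ⟨l, Set.ext fun x => ⟨fun hx => ⟨hx.1, fun y hy => ?_⟩, fun hx => ⟨hx.1, fun h hh => ?_⟩⟩⟩
  · rw [hl, hl]
    refine Finset.sum_le_sum fun h hh => ?_
    have := hx.2 h (by simpa using hh)
    linarith [mem_carrier.1 hy h]
  · have h₁ := hx.2 z hz
    rw [hl, hl, Finset.sum_sub_distrib, Finset.sum_sub_distrib] at h₁
    have h₂ : ∑ h with h ∉ C, P.slack z h = 0 :=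
      Finset.sum_eq_zero fun h hh => hzC h (by simpa using hh)
    have h₃ : ∑ h with h ∉ C, P.slack x h = 0 :=
      le_antisymm (by linarith) (Finset.sum_nonneg fun h _ => mem_carrier.1 hx.1 h)
    exact (Finset.sum_eq_zero_iff_of_nonneg fun h _ => mem_carrier.1 hx.1 h).1 h₃ h (by simpa)

lemma isFace_faceOf {C : Set H} {v : P.Vertex} (hv : P.support v ⊆ C) : P.IsFace (P.faceOf C) :=
  ⟨⟨v.1, Vertex.mem_faceOf.2 hv⟩, isExposed_faceOf C⟩

lemma EdgeOrientation.IsUniqueSink.existsUnique {O : P.EdgeOrientation} (hO : O.IsUniqueSink)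
    {C : Set H} {v : P.Vertex} (hv : P.support v ⊆ C) :
    ∃! u : P.Vertex, P.support u ⊆ C ∧ ∀ w, P.support w ⊆ C → ¬ O.arc u w := by
  simpa only [Vertex.mem_faceOf] using hO _ (isFace_faceOf hv)

/-- Krein–Milman; there are finitely many vertices, so no closure is needed. -/
lemma convexHull_extremePoints_eq {F : Set (EuclideanSpace ℝ (Fin d))}
    (hF : IsExposed ℝ P.carrier F) : convexHull ℝ (F ∩ extremePoints ℝ P.carrier) = F := by
  have : Finite (extremePoints ℝ P.carrier) := inferInstanceAs (Finite P.Vertex)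
  have hfin : (F ∩ extremePoints ℝ P.carrier).Finite := (Set.toFinite _).subset inter_subset_right
  have h := closure_convexHull_extremePoints (hF.isCompact P.isCompact_carrier)
    (hF.convex P.convex_carrier)
  rw [hF.isExtreme.extremePoints_eq, (hfin.isCompact_convexHull ℝ).isClosed.closure_eq] at h
  exact h

lemma adj_of_support {u v : P.Vertex} (hne : u ≠ v)
    (huv : ∀ w, P.support w ⊆ P.support u ∪ P.support v → w = u ∨ w = v) : P.Adj u v := by
  refine ⟨hne, ?_⟩
  have hu : P.support u ⊆ P.support u ∪ P.support v := subset_union_left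
  have hv : P.support v ⊆ P.support u ∪ P.support v := subset_union_right
  have hF := isFace_faceOf hu
  have h := convexHull_extremePoints_eq hF.2
  have hpts : P.faceOf (P.support u ∪ P.support v) ∩ extremePoints ℝ P.carrier = {u.1, v.1} := by
    ext z
    constructor
    · rintro ⟨hz, hz'⟩
      rcases huv ⟨z, hz'⟩ (Vertex.mem_faceOf.1 hz) with h | h
      · exact .inl (congrArg Subtype.val h)
      · exact .inr (congrArg Subtype.val h)
    · rintro (rfl | rfl)
      · exact ⟨Vertex.mem_faceOf.2 hu, u.2⟩
      · exact ⟨Vertex.mem_faceOf.2 hv, v.2⟩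
  rw [hpts, convexHull_pair] at h
  rwa [h]

/-- The midpoint of the edge has positive slack on the union of both supports, so it lies strictly
between `w` and another point of the polytope. As the edge is a face, `w` is in it, hence is an end.
-/
lemma Adj.eq_or_eq {u v : P.Vertex} (huv : P.Adj u v) {w : P.Vertex}
    (hw : P.support w ⊆ P.support u ∪ P.support v) : w = u ∨ w = v := by
  have hhalf : (1 / 2 : ℝ) + 1 / 2 = 1 := by norm_num
  set m := (1 / 2 : ℝ) • u.1 + (1 / 2 : ℝ) • v.1 with hm
  have hmF : m ∈ segment ℝ u.1 v.1 := ⟨1 / 2, 1 / 2, by norm_num, by norm_num, hhalf, rfl⟩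
  have hmP : m ∈ P.carrier := huv.2.2.subset hmF
  obtain ⟨r, hr, hmem⟩ := exists_mem_openSegment (q := w.1) hmP fun h h0 => by
    rw [hm, slack_combo hhalf] at h0
    by_contra hne
    have hwh : h ∈ P.support w :=
      mem_support.2 (lt_of_le_of_ne (mem_carrier.1 w.2.1 h) (Ne.symm hne))
    have h₁ := mem_carrier.1 u.2.1 h
    have h₂ := mem_carrier.1 v.2.1 h
    rcases hw hwh with h' | h' <;> rw [mem_support] at h' <;> linarith
  have hwF := huv.2.2.isExtreme.left_mem_of_mem_openSegment w.2.1 hr hmF hmem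
  rcases (mem_extremePoints_iff_forall_segment.1 w.2).2 _ u.2.1 _ v.2.1 hwF with h | h
  · exact .inl (Subtype.ext h.symm)
  · exact .inr (Subtype.ext h.symm)

end HPolytope

/-! ### Gale duality and the grid of vertices -/

namespace HPolytope

variable {d : ℕ} {H : Type*} [Fintype H] {P : HPolytope d H}

variable (P) in
/-- The linear map that sends `x` to its inner products with the facet normals. -/
noncomputable def normalMap : EuclideanSpace ℝ (Fin d) →ₗ[ℝ] EuclideanSpace ℝ H where
  toFun x := WithLp.toLp 2 fun h => inner ℝ (P.normal h) x
  map_add' x y := by ext h; simp [inner_add_right]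
  map_smul' c x := by ext h; simp [inner_smul_right]

@[simp] lemma normalMap_apply (x : EuclideanSpace ℝ (Fin d)) (h : H) :
    P.normalMap x h = inner ℝ (P.normal h) x := rfl

lemma normalMap_injective : Function.Injective P.normalMap := by
  refine (injective_iff_map_eq_zero _).2 fun x hx => eq_zero_of_inner_nonpos (P := P) fun h => ?_
  rw [← normalMap_apply, hx]
  simp

lemma euclidean_inner_eq_sum (x y : EuclideanSpace ℝ H) : inner ℝ x y = ∑ h, x h * y h := by
  simp [PiLp.inner_apply, mul_comm]

/-- The facet normals of a polytope have a linear relation with positive coefficients. -/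
lemma exists_pos_mem_orthogonal :
    ∃ γ ∈ (LinearMap.range P.normalMap)ᗮ, ∀ h, 0 < γ h := by
  classical
  set U := LinearMap.range P.normalMap with hU
  let s : Set (EuclideanSpace ℝ H) := range fun h => -EuclideanSpace.single h (1 : ℝ)
  have hs : convexHull ℝ s ⊆ {z | (∀ h, z h ≤ 0) ∧ ∑ h, z h = -1} := by
    refine convexHull_min ?_ ?_
    · rintro _ ⟨h, rfl⟩
      refine ⟨fun g => ?_, ?_⟩
      · simp only [PiLp.neg_apply, PiLp.single_apply]
        split_ifs <;> simp
      · simp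
    · rintro x ⟨hx, hx'⟩ y ⟨hy, hy'⟩ a b ha hb hab
      refine ⟨fun h => ?_, ?_⟩
      · have := mul_nonneg ha (neg_nonneg.2 (hx h))
        have := mul_nonneg hb (neg_nonneg.2 (hy h))
        simp only [PiLp.add_apply, PiLp.smul_apply, smul_eq_mul]
        linarith
      · simp only [PiLp.add_apply, PiLp.smul_apply, smul_eq_mul, Finset.sum_add_distrib,
          ← Finset.mul_sum, hx', hy']
        linarith
  have hdisj : Disjoint (convexHull ℝ s) (U : Set (EuclideanSpace ℝ H)) := by
    rw [Set.disjoint_left]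
    rintro _ hz ⟨x, rfl⟩
    obtain ⟨h₁, h₂⟩ := hs hz
    obtain rfl := eq_zero_of_inner_nonpos (P := P) h₁
    simp at h₂
  -- Separate the negative standard simplex from the range of the normal map, which meets the
  -- nonpositive orthant only in zero. Being bounded below on a subspace, `f` vanishes there.
  obtain ⟨f, u, v, hfu, huv, hfv⟩ := geometric_hahn_banach_compact_closed (convex_convexHull ℝ s)
    ((Set.finite_range _).isCompact_convexHull ℝ) U.convex U.closed_of_finiteDimensional hdisj
  have hf0 : ∀ b ∈ U, f b = 0 := by
    intro b hb
    by_contra hne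
    have := hfv ((v / f b) • b) (U.smul_mem _ hb)
    rw [map_smul, smul_eq_mul, div_mul_cancel₀ _ hne] at this
    exact this.false
  have hv0 : v < 0 := by simpa using hfv 0 U.zero_mem
  refine ⟨(InnerProductSpace.toDual ℝ _).symm f, ?_, fun h => ?_⟩
  · rw [Submodule.mem_orthogonal']
    intro b hb
    rw [InnerProductSpace.toDual_symm_apply, hf0 b hb]
  · have h₁ := hfu _ (subset_convexHull ℝ s ⟨h, rfl⟩)
    have h₂ := InnerProductSpace.toDual_symm_apply (𝕜 := ℝ) (x := EuclideanSpace.single h (1 : ℝ))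
      (y := f)
    rw [EuclideanSpace.inner_single_right] at h₂
    simp only [map_neg] at h₁
    simp only [one_mul, conj_trivial] at h₂
    rw [h₂]
    linarith

/-- The slack vectors of the points of `ℝ^d` are the solutions of two linear equations, one of
which is homogeneous and the other one of which has positive coefficients. -/
lemma exists_gale (hcard : Fintype.card H = d + 2) (hP : P.IsSimple) :
    ∃ (β γ : H → ℝ) (c : ℝ), 0 < c ∧ (∀ h, 0 < γ h) ∧ (∀ x, ∑ h, β h * P.slack x h = 0) ∧
      (∀ x, ∑ h, γ h * P.slack x h = c) ∧
      ∀ s : H → ℝ, ∑ h, β h * s h = 0 → ∑ h, γ h * s h = c → ∃ x, ∀ h, P.slack x h = s h := by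
  obtain ⟨γ, hγU, hγ⟩ := exists_pos_mem_orthogonal (P := P)
  set U := LinearMap.range P.normalMap with hU
  let o : EuclideanSpace ℝ H := WithLp.toLp 2 P.offset
  have hslack : ∀ α ∈ Uᗮ, ∀ x, ∑ h, α h * P.slack x h = inner ℝ α o := by
    intro α hα x
    have h₁ := (Submodule.mem_orthogonal' _ _).1 hα _ ⟨x, rfl⟩
    rw [euclidean_inner_eq_sum] at h₁ ⊢
    simp only [slack, mul_sub, Finset.sum_sub_distrib]
    simp only [normalMap_apply] at h₁
    rw [h₁, sub_zero]
  have hpos : 0 < inner ℝ γ o := by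
    obtain ⟨v⟩ := (inferInstance : Nonempty P.Vertex)
    rw [← hslack γ hγU v.1]
    have hnn : ∀ h, 0 ≤ γ h * P.slack v.1 h :=
      fun h => mul_nonneg (hγ h).le (mem_carrier.1 v.2.1 h)
    refine Finset.sum_pos' (fun h _ => hnn h) ?_
    -- Otherwise all `d + 2` slacks of the vertex would vanish, against simplicity.
    by_contra! hcon
    have huniv : {h | inner ℝ (P.normal h) v.1 = P.offset h} = univ := by
      refine eq_univ_of_forall fun h => ?_
      have h₀ := (hcon h (Finset.mem_univ h)).antisymm (hnn h)
      have := (mul_eq_zero.1 h₀).resolve_left (hγ h).ne'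
      simp only [slack] at this
      change _ = _
      linarith
    have := hP v
    rw [huniv, ncard_univ, Nat.card_eq_fintype_card, hcard] at this
    omega
  have hfin : Module.finrank ℝ Uᗮ = 2 := by
    have h₁ := U.finrank_add_finrank_orthogonal
    rw [hU, LinearMap.finrank_range_of_inj normalMap_injective, finrank_euclideanSpace,
      finrank_euclideanSpace, Fintype.card_fin, hcard] at h₁
    rw [hU]
    omega
  let φ : Uᗮ →ₗ[ℝ] ℝ := ((innerₗ (EuclideanSpace ℝ H)) o).comp Uᗮ.subtype
  have hφ : ∀ α : Uᗮ, φ α = inner ℝ (α : EuclideanSpace ℝ H) o := fun α =>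
    real_inner_comm (α : EuclideanSpace ℝ H) o
  have hsurj : Function.Surjective φ := by
    refine LinearMap.surjective fun h0 => hpos.ne' ?_
    have := hφ ⟨γ, hγU⟩
    rw [h0] at this
    exact this.symm
  have hker : Module.finrank ℝ (LinearMap.ker φ) = 1 := by
    have h₁ := φ.finrank_range_add_finrank_ker
    rw [LinearMap.range_eq_top.2 hsurj, finrank_top, Module.finrank_self, hfin] at h₁
    omega
  -- The orthogonal complement has dimension `2`; `β` spans the part of it that is orthogonal to the
  -- offsets.
  obtain ⟨β, -, hβ⟩ := finrank_eq_one_iff'.1 hker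
  have hβo : inner ℝ (β.1.1 : EuclideanSpace ℝ H) o = 0 := by rw [← hφ]; exact β.2
  refine ⟨β.1.1, γ, inner ℝ γ o, hpos, hγ, fun x => ?_, hslack γ hγU, fun s h₁ h₂ => ?_⟩
  · rw [hslack _ β.1.2, hβo]
  have hmem : o - WithLp.toLp 2 s ∈ Uᗮᗮ := by
    rw [Submodule.mem_orthogonal]
    intro α hα
    -- Subtracting `t • γ` moves `α` into the line spanned by `β`.
    set t := inner ℝ α o / inner ℝ γ o with ht
    have hzero : (⟨α - t • γ, Uᗮ.sub_mem hα (Uᗮ.smul_mem t hγU)⟩ : Uᗮ) ∈ LinearMap.ker φ := by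
      rw [LinearMap.mem_ker, hφ]
      simp only [inner_sub_left, inner_smul_left, conj_trivial]
      rw [ht, div_mul_cancel₀ _ hpos.ne', sub_self]
    obtain ⟨r, hr⟩ := hβ ⟨_, hzero⟩
    have hα' : α = r • β.1.1 + t • γ := by
      have := congrArg (fun z => (z.1.1 : EuclideanSpace ℝ H)) hr
      simp only at this
      rw [eq_sub_iff_add_eq] at this
      exact this.symm
    have hβs : inner ℝ (β.1.1 : EuclideanSpace ℝ H) (WithLp.toLp 2 s) = 0 := by
      rw [euclidean_inner_eq_sum]; exact h₁
    have hγs : inner ℝ γ (WithLp.toLp 2 s) = inner ℝ γ o := by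
      rw [← h₂, euclidean_inner_eq_sum]
    rw [hα', inner_add_left, inner_smul_left, inner_smul_left, inner_sub_right, inner_sub_right,
      hβo, hβs, hγs]
    simp
  rw [Submodule.orthogonal_orthogonal] at hmem
  obtain ⟨x, hx⟩ := hmem
  refine ⟨x, fun h => ?_⟩
  have := congrArg (fun z : EuclideanSpace ℝ H => z h) hx
  simp only [normalMap_apply, PiLp.sub_apply] at this
  simp only [slack, this, o]
  ring

/-- The ends of an open segment through `x` are tight wherever `x` is, so uniqueness identifies them
with `x`. -/
lemma mem_extremePoints_of_slack {x : EuclideanSpace ℝ (Fin d)} (hx : x ∈ P.carrier)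
    (huniq : ∀ y ∈ P.carrier, (∀ h, P.slack x h = 0 → P.slack y h = 0) →
      ∀ h, P.slack y h = P.slack x h) : x ∈ extremePoints ℝ P.carrier := by
  refine mem_extremePoints_iff_left.2 ⟨hx, fun y hy z hz hmem => ?_⟩
  refine eq_of_slack_eq (huniq y hy fun h h0 => ?_)
  obtain ⟨a, b, ha, hb, hab, rfl⟩ := hmem
  rw [slack_combo hab] at h0
  have h₁ := mem_carrier.1 hy h
  have h₂ := mem_carrier.1 hz h
  nlinarith [mul_nonneg ha.le h₁, mul_nonneg hb.le h₂]

lemma ncard_support (hcard : Fintype.card H = d + 2) (hP : P.IsSimple) (v : P.Vertex) :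
    (P.support v).ncard = 2 := by
  have h₁ : {h | inner ℝ (P.normal h) v.1 = P.offset h} = (P.support v)ᶜ := by
    ext h
    have := v.2.1 h
    simp only [support, mem_compl_iff, mem_ofPred_eq, not_lt]
    exact ⟨fun h => h.ge, fun h' => le_antisymm this h'⟩
  have h₂ := hP v
  have h₃ := ncard_add_ncard_compl (P.support v)
  rw [h₁] at h₂
  rw [h₂, Nat.card_eq_fintype_card, hcard] at h₃
  omega

/-- The vertices of a simple polytope with `d + 2` facets form a grid. -/
theorem exists_isGridPartition (hcard : Fintype.card H = d + 2) (hP : P.IsSimple) :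
    ∃ X Y : Set H, P.IsGridPartition X Y := by
  classical
  obtain ⟨β, γ, c, hc, hγ, hβs, hγs, hex⟩ := exists_gale hcard hP
  -- A zero coefficient would produce a vertex with at most one positive slack, whereas simplicity
  -- gives two.
  have hβ : ∀ h, β h ≠ 0 := by
    intro h h0
    obtain ⟨x, hx⟩ := hex (Pi.single h (c / γ h))
      (Finset.sum_eq_zero fun g _ => by
        rcases eq_or_ne g h with rfl | hne
        · simp [h0]
        · simp [hne])
      (by rw [Fintype.sum_eq_single h fun g hg => by simp [hg]]
          simp [mul_div_cancel₀ _ (hγ h).ne'])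
    have hxP : x ∈ P.carrier := mem_carrier.2 fun g => by
      rw [hx]
      exact (Pi.single_nonneg (α := fun _ : H => ℝ)).2 (div_nonneg hc.le (hγ h).le) g
    have hv : x ∈ extremePoints ℝ P.carrier := by
      refine mem_extremePoints_of_slack hxP fun y hy hy0 g => ?_
      have h₁ : ∀ g, g ≠ h → P.slack y g = 0 := fun g hg => hy0 g (by simp [hx, hg])
      rcases eq_or_ne g h with rfl | hne
      · have h₂ := hγs y
        rw [Fintype.sum_eq_single g fun g' hg => by simp [h₁ g' hg]] at h₂
        rw [hx, Pi.single_eq_same, eq_div_iff (hγ g).ne', mul_comm, h₂]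
      · rw [h₁ g hne, hx, Pi.single_eq_of_ne hne]
    obtain ⟨v, rfl⟩ : ∃ v : P.Vertex, v.1 = x := ⟨⟨x, hv⟩, rfl⟩
    have h₁ := ncard_support hcard hP v
    have h₂ : P.support v ⊆ {h} := fun g hg => by
      rw [mem_support, hx] at hg
      by_contra hne
      rw [Pi.single_eq_of_ne hne] at hg
      exact hg.false
    have := ncard_le_ncard h₂
    rw [ncard_singleton] at this
    omega
  refine ⟨{h | 0 < β h}, {h | β h < 0}, ?_, ?_⟩
  · rw [← eq_compl_iff_isCompl]
    ext h
    simp only [mem_ofPred_eq, mem_compl_iff, not_lt]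
    exact ⟨le_of_lt, fun h' => lt_of_le_of_ne h' (hβ h).symm⟩
  ext S
  constructor
  · rintro ⟨v, rfl⟩
    obtain ⟨a, b, hab, hS⟩ := ncard_eq_two.1 (ncard_support hcard hP v)
    have ha : 0 < P.slack v.1 a := mem_support.1 (hS ▸ mem_insert a _)
    have hb : 0 < P.slack v.1 b := mem_support.1 (hS ▸ mem_insert_of_mem a rfl)
    have h₁ := hβs v.1
    rw [Fintype.sum_eq_add a b hab fun g hg => ?_] at h₁
    · rcases (hβ a).lt_or_gt with h | h
      · have h₂ : 0 < β b := by
          by_contra! h'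
          nlinarith [mul_pos_of_neg_of_neg h (neg_lt_zero.2 ha),
            mul_nonneg (neg_nonneg.2 h') hb.le]
        exact ⟨b, h₂, a, h, by rw [hS, pair_comm]⟩
      · have h₂ : β b < 0 := by
          by_contra! h'
          nlinarith [mul_pos h ha, mul_nonneg h' hb.le]
        exact ⟨a, h, b, h₂, hS⟩
    · have : g ∉ P.support v := by rw [hS]; simp [hg.1, hg.2]
      rw [mem_support, not_lt] at this
      rw [this.antisymm (mem_carrier.1 v.2.1 g), mul_zero]
  · rintro ⟨x, hx, y, hy, rfl⟩
    have hx : 0 < β x := hx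
    have hy : β y < 0 := hy
    have hxy : x ≠ y := by rintro rfl; exact hx.not_gt hy
    have hD : 0 < γ y * β x - γ x * β y := by
      have := mul_pos (hγ y) hx
      have := mul_pos_of_neg_of_neg (neg_lt_zero.2 (hγ x)) hy
      linarith
    -- Cramer's rule for the two equations restricted to the coordinates `x` and `y`; the opposite
    -- signs of `β` make the solution positive.
    set t := c / (γ y * β x - γ x * β y) with ht
    have ht0 : 0 < t := div_pos hc hD
    have htD : t * (γ y * β x - γ x * β y) = c := div_mul_cancel₀ _ hD.ne'
    let s : H → ℝ := fun h => if h = x then -β y * t else if h = y then β x * t else 0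
    have hsx : s x = -β y * t := by simp [s]
    have hsy : s y = β x * t := by simp [s, hxy.symm]
    have hs0 : ∀ g, g ≠ x ∧ g ≠ y → s g = 0 := fun g hg => by simp [s, hg.1, hg.2]
    obtain ⟨p, hp⟩ := hex s
      (by rw [Fintype.sum_eq_add x y hxy fun g hg => by rw [hs0 g hg, mul_zero], hsx, hsy]; ring)
      (by rw [Fintype.sum_eq_add x y hxy fun g hg => by rw [hs0 g hg, mul_zero], hsx, hsy, ← htD]
          ring)
    have hpx : 0 < P.slack p x := by rw [hp, hsx]; exact mul_pos (neg_pos.2 hy) ht0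
    have hpy : 0 < P.slack p y := by rw [hp, hsy]; exact mul_pos hx ht0
    have hp0 : ∀ g, g ≠ x ∧ g ≠ y → P.slack p g = 0 := fun g hg => by rw [hp, hs0 g hg]
    have hpP : p ∈ P.carrier := mem_carrier.2 fun g => by
      by_cases h₁ : g = x
      · rw [h₁]; exact hpx.le
      by_cases h₂ : g = y
      · rw [h₂]; exact hpy.le
      exact (hp0 g ⟨h₁, h₂⟩).ge
    have hv : p ∈ extremePoints ℝ P.carrier := by
      refine mem_extremePoints_of_slack hpP fun q hq hq0 => ?_
      have hq0 : ∀ g, g ≠ x ∧ g ≠ y → P.slack q g = 0 := fun g hg => hq0 g (hp0 g hg)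
      have h₁ := hβs q
      have h₂ := hγs q
      rw [Fintype.sum_eq_add x y hxy fun g hg => by rw [hq0 g hg, mul_zero]] at h₁ h₂
      have hqx : P.slack q x = -β y * t := by
        refine mul_left_cancel₀ hD.ne' ?_
        linear_combination γ y * h₁ - β y * h₂ + β y * htD
      have hqy : P.slack q y = β x * t := by
        refine mul_left_cancel₀ hD.ne' ?_
        linear_combination (-γ x) * h₁ + β x * h₂ - β x * htD
      intro g
      by_cases h₃ : g = x
      · rw [h₃, hqx, hp, hsx]
      by_cases h₄ : g = y
      · rw [h₄, hqy, hp, hsy]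
      rw [hq0 g ⟨h₃, h₄⟩, hp0 g ⟨h₃, h₄⟩]
    obtain ⟨v, rfl⟩ : ∃ v : P.Vertex, v.1 = p := ⟨⟨p, hv⟩, rfl⟩
    refine ⟨v, ?_⟩
    ext g
    rw [mem_support]
    by_cases h₁ : g = x
    · simp [h₁, hpx]
    by_cases h₂ : g = y
    · simp [h₂, hpy]
    simp [h₁, h₂, hp0 g ⟨h₁, h₂⟩]

/-- No facet-defining halfspace contains all vertices in its interior. -/
lemma exists_notMem_support (h : H) : ∃ v : P.Vertex, h ∉ P.support v := by
  by_contra! hall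
  obtain ⟨v⟩ := (inferInstance : Nonempty P.Vertex)
  have hpos : ∀ p ∈ P.carrier, 0 < P.slack p h := by
    have h₁ := convexHull_extremePoints_eq (P := P) (IsExposed.refl P.carrier)
    rw [inter_eq_right.2 extremePoints_subset] at h₁
    intro p hp
    rw [← h₁] at hp
    refine convexHull_min (t := {p | 0 < P.slack p h}) (fun z hz => ?_) ?_ hp
    · exact mem_support.1 (hall ⟨z, hz⟩)
    · intro x hx y hy a b ha hb hab
      have hx : 0 < P.slack x h := hx
      have hy : 0 < P.slack y h := hy
      rw [mem_ofPred_eq, slack_combo hab]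
      rcases ha.eq_or_lt with rfl | ha
      · obtain rfl : b = 1 := by linarith
        simpa using hy
      · exact add_pos_of_pos_of_nonneg (mul_pos ha hx) (mul_nonneg hb hy.le)
  obtain ⟨z, hz, hzh⟩ := P.irredundant h
  have hv := mem_support.1 (hall v)
  have hz0 : P.slack z h < 0 := by simp only [slack]; linarith
  have hD : 0 < P.slack v.1 h - P.slack z h := by linarith
  -- The point where the segment from `v` to the witness `z` of irredundancy meets the hyperplane of
  -- `h`. It satisfies all other inequalities, so it lies in the polytope with zero slack at `h`.
  set t := P.slack v.1 h / (P.slack v.1 h - P.slack z h) with ht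
  have ht0 : 0 ≤ t := div_nonneg hv.le hD.le
  have ht1 : t ≤ 1 := (div_le_one hD).2 (by linarith)
  have htD : t * (P.slack v.1 h - P.slack z h) = P.slack v.1 h := div_mul_cancel₀ _ hD.ne'
  have hzero : P.slack ((1 - t) • v.1 + t • z) h = 0 := by
    rw [slack_combo (by ring)]
    linarith
  refine (hpos ((1 - t) • v.1 + t • z) (mem_carrier.2 fun g => ?_)).ne' hzero
  rcases eq_or_ne g h with rfl | hne
  · exact hzero.ge
  · rw [slack_combo (by ring)]
    have h₁ := mem_carrier.1 v.2.1 g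
    have h₂ : 0 ≤ P.slack z g := by simp only [slack]; linarith [hz g hne]
    have h₃ : 0 ≤ 1 - t := by linarith
    positivity

end HPolytope

/-! ### The phases between milestones -/

namespace GridOrientation

open Relation

variable {α β : Type*} [Fintype α] [Fintype β] {G : GridOrientation α β}

open Classical in
lemma sum_arc {M : Type*} [AddCommMonoid M] (v : α × β) (g : α × β → M) :
    ∑ q with G.Arc v q, g q = ∑ x ∈ G.outX v, g (x, v.2) + ∑ y ∈ G.outY v, g (v.1, y) := by
  have hunion : ({q | G.Arc v q} : Finset (α × β)) =
      (G.outX v).image (fun x => (x, v.2)) ∪ (G.outY v).image (fun y => (v.1, y)) := by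
    ext ⟨x, y⟩
    simp only [Finset.mem_filter_univ, Finset.mem_union, Finset.mem_image, mem_outX, mem_outY,
      Prod.mk.injEq]
    constructor
    · rintro (⟨h, h'⟩ | ⟨h, h'⟩)
      · exact .inl ⟨x, h', rfl, h⟩
      · exact .inr ⟨y, h', h, rfl⟩
    · rintro (⟨_, h, rfl, h'⟩ | ⟨_, h, h', rfl⟩)
      · exact .inl ⟨h', h⟩
      · exact .inr ⟨h', h⟩
  have hdisj : Disjoint ((G.outX v).image fun x => (x, v.2))
      ((G.outY v).image fun y => (v.1, y)) := by
    rw [Finset.disjoint_left]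
    intro q hq hq'
    obtain ⟨x, hx, rfl⟩ := Finset.mem_image.1 hq
    obtain ⟨y, -, hy⟩ := Finset.mem_image.1 hq'
    have : v.1 = x := congrArg Prod.fst hy
    rw [mem_outX, ← this] at hx
    exact G.hor_irrefl _ _ hx
  rw [hunion, Finset.sum_union hdisj, Finset.sum_image fun _ _ _ _ h => congrArg Prod.fst h,
    Finset.sum_image fun _ _ _ _ h => congrArg Prod.snd h]

/-- The time bound for the last phase, which ends in the sink. -/
theorem le_harmonic_of_sink {p p' : α × β} (hpX : G.outX p = ∅) (hpY : G.outY p = ∅)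
    (hpX' : (G.outX p').card = 1) (hpY' : (G.outY p').card = 1) {h : α × β → ℝ}
    (hnonneg : ∀ v, 0 ≤ h v) (htarget : h p = 0)
    (hmean : ∀ v, v ≠ p → 0 < (G.outX v).card + (G.outY v).card →
      ((G.outX v).card + (G.outY v).card) * h v ≤
        ((G.outX v).card + (G.outY v).card) + ∑ x ∈ G.outX v, h (x, v.2) +
          ∑ y ∈ G.outY v, h (v.1, y))
    {v : α × β} (hv : TransGen G.Arc p' v) :
    h v ≤ 155 * ((harmonic (Fintype.card α + Fintype.card β) : ℝ) + 1) := by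
  have harc : ∀ v, ¬ G.Arc p v := by
    rintro v (⟨-, h⟩ | ⟨-, h⟩)
    · simpa [hpX] using mem_outX.2 h
    · simpa [hpY] using mem_outY.2 h
  have htrans : ∀ v, ¬ TransGen G.Arc p v := fun v hv => by
    obtain ⟨u, hu, -⟩ := TransGen.head'_iff.1 hv
    exact harc u hu
  have hsub : ∀ v, v ≠ p → {p.1} ⊆ G.outX v ∨ {p.2} ⊆ G.outY v := by
    rintro ⟨x, y⟩ hne
    obtain ⟨s, t⟩ := p
    simp only [Finset.singleton_subset_iff, mem_outX, mem_outY]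
    rcases eq_or_ne x s with rfl | hx
    · have hy : y ≠ t := by rintro rfl; exact hne rfl
      exact .inr ((G.ver_total x y t hy).resolve_right fun h' => harc _ (arc_ver h'))
    rcases eq_or_ne y t with rfl | hy
    · exact .inl ((G.hor_total y x s hx).resolve_right fun h' => harc _ (arc_hor h'))
    -- If `v` pointed neither to the column nor to the row of the sink, `v` would be reachable from
    -- the sink.
    · refine (G.hor_total y x s hx).imp id fun h₁ => ?_
      exact (G.ver_total x y t hy).resolve_right fun h₂ =>
        htrans _ (transGen_of_square .refl hx hy h₁ h₂)
  have hX := card_outX_lt (G := G) p'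
  have hY := card_outY_lt (G := G) p'
  obtain ⟨M, hM⟩ := (finite_range h).bddAbove
  have H : IsPhase G 1 {v | TransGen G.Arc p' v} {p} {p.1} {p.2} h M :=
    { one_le := le_rfl
      le_card_left := by omega
      le_card_right := by omega
      mem_of_arc := fun v v' hv ha => TransGen.tail hv ha
      target_of_arc := by rintro v v' rfl ha; exact (harc _ ha).elim
      degree_le := fun v hv => by
        -- One degree is even zero here; `k = 1` fits the last phase into the general scheme.
        have := card_lt_of_transGen hv
        omega
      card_left := Finset.card_singleton _
      card_right := Finset.card_singleton _
      subgrid := fun x hx y hy => by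
        rw [Finset.mem_singleton.1 hx, Finset.mem_singleton.1 hy]
        rfl
      subset_or_subset := hsub
      nonneg := hnonneg
      le_bound := fun v _ => hM ⟨v, rfl⟩
      target := by rintro v rfl; exact htarget
      le_mean := fun v _ hw => hmean v hw (by
        rcases hsub v hw with h' | h' <;> have := Finset.card_le_card h' <;>
          rw [Finset.card_singleton] at this <;> omega) }
  exact H.le_harmonic hv

/-- The time bound for a phase that ends in a vertex reachable from `p`. -/
theorem le_harmonic_of_transGen {p p' : α × β} {k : ℕ} (hk : 1 ≤ k) (hpX : (G.outX p).card = k)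
    (hpY : (G.outY p).card = k) (hpX' : (G.outX p').card = 2 * k)
    (hpY' : (G.outY p').card = 2 * k) {h : α × β → ℝ} (hnonneg : ∀ v, 0 ≤ h v)
    (htarget : ∀ v, TransGen G.Arc p v → h v = 0)
    (hmean : ∀ v, ¬ TransGen G.Arc p v → 0 < (G.outX v).card + (G.outY v).card →
      ((G.outX v).card + (G.outY v).card) * h v ≤
        ((G.outX v).card + (G.outY v).card) + ∑ x ∈ G.outX v, h (x, v.2) +
          ∑ y ∈ G.outY v, h (v.1, y))
    {v : α × β} (hv : TransGen G.Arc p' v) :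
    h v ≤ 155 * ((harmonic (Fintype.card α + Fintype.card β) : ℝ) + 1) := by
  have hsub : ∀ v, ¬ TransGen G.Arc p v → G.outX p ⊆ G.outX v ∨ G.outY p ⊆ G.outY v := by
    intro v hv
    refine (hor_or_ver_of_not_transGen hv).imp (fun h' x hx => ?_) fun h' y hy => ?_
    · exact mem_outX.2 (h' x (mem_outX.1 hx))
    · exact mem_outY.2 (h' y (mem_outY.1 hy))
  have hX := card_outX_lt (G := G) p'
  have hY := card_outY_lt (G := G) p'
  obtain ⟨M, hM⟩ := (finite_range h).bddAbove
  have H : IsPhase G k {v | TransGen G.Arc p' v} {v | TransGen G.Arc p v} (G.outX p) (G.outY p)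
      h M :=
    { one_le := hk
      le_card_left := by omega
      le_card_right := by omega
      mem_of_arc := fun v v' hv ha => TransGen.tail hv ha
      target_of_arc := fun v v' hv ha => TransGen.tail hv ha
      degree_le := fun v hv => by
        -- Being reachable from a vertex of degrees `(2 * k, 2 * k)`, `v` has one degree below `2 *
        -- k`.
        have := card_lt_of_transGen hv
        omega
      card_left := hpX
      card_right := hpY
      subgrid := fun x hx y hy => transGen_of_hor_of_ver (mem_outX.1 hx) (mem_outY.1 hy)
      subset_or_subset := hsub
      nonneg := hnonneg
      le_bound := fun v _ => hM ⟨v, rfl⟩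
      target := htarget
      le_mean := fun v _ hw => hmean v hw (by
        rcases hsub v hw with h' | h' <;> have := Finset.card_le_card h' <;> omega) }
  exact H.le_harmonic hv

end GridOrientation

/-! ### From polytopes to grids -/

namespace HPolytope

open Relation

variable {d : ℕ} {H : Type*} [Fintype H] {P : HPolytope d H} {X Y : Set H}

namespace IsGridPartition

lemma ne (hXY : P.IsGridPartition X Y) {x y : H} (hx : x ∈ X) (hy : y ∈ Y) : x ≠ y := by
  rintro rfl
  exact Set.disjoint_left.1 hXY.1.disjoint hx hy

lemma symm (hXY : P.IsGridPartition X Y) : P.IsGridPartition Y X := by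
  refine ⟨hXY.1.symm, hXY.2.trans (Set.ext fun S => ?_)⟩
  constructor
  · rintro ⟨x, hx, y, hy, rfl⟩
    exact ⟨y, hy, x, hx, pair_comm x y⟩
  · rintro ⟨y, hy, x, hx, rfl⟩
    exact ⟨x, hx, y, hy, pair_comm y x⟩

/-- With a single element, that halfspace would contain every vertex in its interior. The bound
makes the logarithm in `numMilestones` meaningful. -/
lemma two_le_ncard (hXY : P.IsGridPartition X Y) : 2 ≤ X.ncard := by
  obtain ⟨v⟩ := (inferInstance : Nonempty P.Vertex)
  have hex : ∀ v : P.Vertex, ∃ x ∈ X, x ∈ P.support v := fun v => by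
    obtain ⟨x, hx, y, -, h⟩ : P.support v ∈ {S | ∃ x ∈ X, ∃ y ∈ Y, S = {x, y}} :=
      hXY.2 ▸ mem_range_self v
    exact ⟨x, hx, h ▸ mem_insert x _⟩
  obtain ⟨x, hx, -⟩ := hex v
  obtain ⟨u, hu⟩ := exists_notMem_support (P := P) x
  obtain ⟨x', hx', hxu⟩ := hex u
  exact (one_lt_ncard_iff).2 ⟨x, x', hx, hx', by rintro rfl; exact hu hxu⟩

/-- The vertices of the polytope, as the vertices of a grid. -/
lemma exists_equiv (hXY : P.IsGridPartition X Y) :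
    ∃ e : X × Y ≃ P.Vertex, ∀ p, P.support (e p) = {p.1.1, p.2.1} := by
  have hex : ∀ p : X × Y, ∃ v : P.Vertex, P.support v = {p.1.1, p.2.1} := fun p => by
    have : ({p.1.1, p.2.1} : Set H) ∈ range P.support := by
      rw [hXY.2]
      exact ⟨p.1, p.1.2, p.2, p.2.2, rfl⟩
    exact this
  choose f hf using hex
  refine ⟨Equiv.ofBijective f ⟨fun p q hpq => ?_, fun v => ?_⟩, hf⟩
  · have h := (hf p).symm.trans ((congrArg _ hpq).trans (hf q))
    have h₁ : p.1.1 ∈ ({q.1.1, q.2.1} : Set H) := h ▸ mem_insert _ _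
    have h₂ : p.2.1 ∈ ({q.1.1, q.2.1} : Set H) := h ▸ mem_insert_of_mem _ rfl
    refine Prod.ext (Subtype.ext ?_) (Subtype.ext ?_)
    · exact h₁.resolve_right (hXY.ne p.1.2 q.2.2)
    · exact h₂.resolve_left (hXY.ne q.1.2 p.2.2).symm
  · obtain ⟨x, hx, y, hy, h⟩ : P.support v ∈ {S | ∃ x ∈ X, ∃ y ∈ Y, S = {x, y}} :=
      hXY.2 ▸ mem_range_self v
    exact ⟨(⟨x, hx⟩, ⟨y, hy⟩), support_injective ((hf _).trans h.symm)⟩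

variable {e : X × Y ≃ P.Vertex}

lemma mem_support_left (hXY : P.IsGridPartition X Y)
    (he : ∀ p, P.support (e p) = {p.1.1, p.2.1}) {p : X × Y} {x : X} :
    x.1 ∈ P.support (e p) ↔ x = p.1 := by
  rw [he]
  constructor
  · exact fun h => Subtype.ext (h.resolve_right (hXY.ne x.2 p.2.2))
  · rintro rfl
    exact mem_insert _ _

lemma mem_support_right (hXY : P.IsGridPartition X Y)
    (he : ∀ p, P.support (e p) = {p.1.1, p.2.1}) {p : X × Y} {y : Y} :
    y.1 ∈ P.support (e p) ↔ y = p.2 := by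
  rw [he]
  constructor
  · exact fun h => Subtype.ext (h.resolve_left (hXY.ne p.1.2 y.2).symm)
  · rintro rfl
    exact mem_insert_of_mem _ rfl

/-- The corner `(p.1, q.2)` lies in the face spanned by `p` and `q`, so on an edge it must equal one
of the ends. -/
lemma adj_iff (hXY : P.IsGridPartition X Y) (he : ∀ p, P.support (e p) = {p.1.1, p.2.1})
    {p q : X × Y} : P.Adj (e p) (e q) ↔ p ≠ q ∧ (p.1 = q.1 ∨ p.2 = q.2) := by
  constructor
  · refine fun h => ⟨fun hpq => h.1 (congrArg e hpq), ?_⟩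
    have hsub : P.support (e (p.1, q.2)) ⊆ P.support (e p) ∪ P.support (e q) := by
      rw [he, he, he]
      rintro z (rfl | rfl)
      · exact .inl (mem_insert _ _)
      · exact .inr (mem_insert_of_mem _ rfl)
    rcases h.eq_or_eq hsub with h' | h'
    · have := e.injective h'
      exact .inr (congrArg Prod.snd this).symm
    · have := e.injective h'
      exact .inl (Prod.ext_iff.1 this).1
  · rintro ⟨hne, hpq⟩
    refine adj_of_support (fun h => hne (e.injective h)) fun w hw => ?_
    obtain ⟨r, rfl⟩ := e.surjective w
    have h₁ : r.1 = p.1 ∨ r.1 = q.1 := by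
      have := hw ((mem_support_left hXY he).2 rfl)
      exact this.imp (mem_support_left hXY he).1 (mem_support_left hXY he).1
    have h₂ : r.2 = p.2 ∨ r.2 = q.2 := by
      have := hw ((mem_support_right hXY he).2 rfl)
      exact this.imp (mem_support_right hXY he).1 (mem_support_right hXY he).1
    simp only [e.injective.eq_iff, Prod.ext_iff]
    rcases hpq with h | h
    · rw [h] at h₁ ⊢
      tauto
    · rw [h] at h₂ ⊢
      tauto

variable {O : P.EdgeOrientation}

/-- Every non-empty subgrid has a unique sink. -/
lemma existsUnique_sink (hXY : P.IsGridPartition X Y)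
    (he : ∀ p, P.support (e p) = {p.1.1, p.2.1}) (hO : O.IsUniqueSink) (A : Set X) (B : Set Y)
    {p : X × Y} (hpA : p.1 ∈ A) (hpB : p.2 ∈ B) :
    ∃! u : X × Y, (u.1 ∈ A ∧ u.2 ∈ B) ∧ ∀ w : X × Y, w.1 ∈ A ∧ w.2 ∈ B → ¬ O.arc (e u) (e w) := by
  have hsub : ∀ q : X × Y, P.support (e q) ⊆ Subtype.val '' A ∪ Subtype.val '' B ↔
      q.1 ∈ A ∧ q.2 ∈ B := by
    intro q
    constructor
    · intro h
      constructor
      · rcases h ((mem_support_left hXY he).2 rfl) with ⟨x, hx, h'⟩ | ⟨y, hy, h'⟩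
        · rwa [← Subtype.ext h']
        · exact (hXY.ne q.1.2 y.2 h'.symm).elim
      · rcases h ((mem_support_right hXY he).2 rfl) with ⟨x, hx, h'⟩ | ⟨y, hy, h'⟩
        · exact (hXY.ne x.2 q.2.2 h').elim
        · rwa [← Subtype.ext h']
    · rintro ⟨h₁, h₂⟩
      rw [he]
      rintro z (rfl | rfl)
      · exact .inl ⟨_, h₁, rfl⟩
      · exact .inr ⟨_, h₂, rfl⟩
  obtain ⟨u, hu, huniq⟩ := hO.existsUnique ((hsub p).2 ⟨hpA, hpB⟩)
  obtain ⟨r, rfl⟩ := e.surjective u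
  refine ⟨r, ⟨(hsub r).1 hu.1, fun w hw => hu.2 _ ((hsub w).2 hw)⟩, fun q hq => ?_⟩
  refine e.injective (huniq (e q) ⟨(hsub q).2 hq.1, fun w hw => ?_⟩)
  obtain ⟨w, rfl⟩ := e.surjective w
  exact hq.2 w ((hsub w).1 hw)

/-- A unique sink orientation of the polytope is a grid orientation. -/
lemma exists_gridOrientation (hXY : P.IsGridPartition X Y)
    (he : ∀ p, P.support (e p) = {p.1.1, p.2.1}) (hO : O.IsUniqueSink) :
    ∃ G : GridOrientation X Y, ∀ p q, O.arc (e p) (e q) ↔ G.Arc p q := by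
  have hadj : ∀ {p q}, O.arc (e p) (e q) → p ≠ q ∧ (p.1 = q.1 ∨ p.2 = q.2) :=
    fun h => (adj_iff hXY he).1 (O.adj_of_arc _ _ h)
  have hasymm : ∀ {p q}, O.arc (e p) (e q) → ¬ O.arc (e q) (e p) := by
    intro p q h h'
    rcases O.xor_of_adj _ _ (O.adj_of_arc _ _ h) with ⟨_, h₂⟩ | ⟨_, h₂⟩
    · exact h₂ h'
    · exact h₂ h
  have htotal : ∀ {p q : X × Y}, p ≠ q → (p.1 = q.1 ∨ p.2 = q.2) →
      O.arc (e p) (e q) ∨ O.arc (e q) (e p) := fun h h' =>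
    (O.xor_of_adj _ _ ((adj_iff hXY he).2 ⟨h, h'⟩)).or
  have hsink := fun A B p => existsUnique_sink hXY he hO A B (p := p)
  refine ⟨{
    hor := fun y x x' => O.arc (e (x, y)) (e (x', y))
    ver := fun x y y' => O.arc (e (x, y)) (e (x, y'))
    hor_irrefl := fun y x h => (hadj h).1 rfl
    ver_irrefl := fun x y h => (hadj h).1 rfl
    hor_total := fun y x x' h => htotal (by simpa using h) (.inr rfl)
    ver_total := fun x y y' h => htotal (by simpa using h) (.inl rfl)
    hor_trans := fun y x x' x'' h₁ h₂ => ?_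
    ver_trans := fun x y y' y'' h₁ h₂ => ?_
    no_opposite_sinks := fun x x' y y' h₁ h₂ h₃ h₄ => ?_
    no_square_cycle := fun x x' y y' h₁ h₂ h₃ h₄ => ?_ }, fun p q => ?_⟩
  · have hne : x ≠ x'' := by rintro rfl; exact hasymm h₁ h₂
    refine (htotal (p := (x, y)) (q := (x'', y)) (by simpa using hne) (.inr rfl)).resolve_right
      fun h₃ => ?_
    -- A directed triangle in a row would be a face without a sink.
    obtain ⟨⟨a, b⟩, ⟨⟨ha, rfl⟩, hs⟩, -⟩ := hsink {x, x', x''} {y} (x, y) (by simp) rfl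
    rcases ha with rfl | rfl | rfl
    · exact hs (x', b) (by simp) h₁
    · exact hs (x'', b) (by simp) h₂
    · exact hs (x, b) (by simp) h₃
  · have hne : y ≠ y'' := by rintro rfl; exact hasymm h₁ h₂
    refine (htotal (p := (x, y)) (q := (x, y'')) (by simpa using hne) (.inl rfl)).resolve_right
      fun h₃ => ?_
    obtain ⟨⟨a, b⟩, ⟨⟨rfl, hb⟩, hs⟩, -⟩ := hsink {x} {y, y', y''} (x, y) rfl (by simp)
    rcases hb with rfl | rfl | rfl
    · exact hs (a, y') (by simp) h₁
    · exact hs (a, y'') (by simp) h₂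
    · exact hs (a, y) (by simp) h₃
  · obtain ⟨u, -, huniq⟩ := hsink {x, x'} {y, y'} (x, y) (by simp) (by simp)
    have hxx : x ≠ x' := by rintro rfl; exact (hadj h₁).1 rfl
    have hyy : y ≠ y' := by rintro rfl; exact (hadj h₂).1 rfl
    have e₁ := huniq (x, y) ⟨by simp, by
      rintro ⟨a, b⟩ ⟨h₅, h₆⟩ h
      rcases h₅ with rfl | rfl <;> rcases h₆ with rfl | rfl
      · exact (hadj h).1 rfl
      · exact hasymm h h₂
      · exact hasymm h h₁
      · exact (hadj h).2.elim hxx hyy⟩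
    have e₂ := huniq (x', y') ⟨by simp, by
      rintro ⟨a, b⟩ ⟨h₅, h₆⟩ h
      rcases h₅ with rfl | rfl <;> rcases h₆ with rfl | rfl
      · exact (hadj h).2.elim hxx.symm hyy.symm
      · exact hasymm h h₃
      · exact hasymm h h₄
      · exact (hadj h).1 rfl⟩
    exact hxx (congrArg Prod.fst (e₁.trans e₂.symm))
  · obtain ⟨⟨a, b⟩, ⟨⟨ha, hb⟩, hs⟩, -⟩ := hsink {x, x'} {y, y'} (x, y) (by simp) (by simp)
    rcases ha with rfl | rfl <;> rcases hb with rfl | rfl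
    · exact hs (x', b) (by simp) h₁
    · exact hs (a, y) (by simp) h₄
    · exact hs (a, y') (by simp) h₂
    · exact hs (x, b) (by simp) h₃
  · obtain ⟨x, y⟩ := p
    obtain ⟨x', y'⟩ := q
    constructor
    · intro h
      rcases (hadj h).2 with h' | h' <;> simp only at h' <;> subst h'
      · exact .inr ⟨rfl, h⟩
      · exact .inl ⟨rfl, h⟩
    · rintro (⟨h', h⟩ | ⟨h', h⟩) <;> simp only at h' <;> subst h' <;> exact h

variable {G : GridOrientation X Y} [Fintype X] [Fintype Y]

lemma refinedOutDegree_eq (hXY : P.IsGridPartition X Y)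
    (he : ∀ p, P.support (e p) = {p.1.1, p.2.1}) (hG : ∀ p q, O.arc (e p) (e q) ↔ G.Arc p q)
    (p : X × Y) : O.refinedOutDegree X Y (e p) = ((G.outX p).card, (G.outY p).card) := by
  refine Prod.ext ?_ ?_
  · have : O.outmap (e p) ∩ X = Subtype.val '' (G.outX p : Set X) := by
      ext x
      constructor
      · rintro ⟨⟨hx, w, hw, hxw⟩, hxX⟩
        obtain ⟨q, rfl⟩ := e.surjective w
        have hq := (mem_support_left hXY he (x := ⟨x, hxX⟩)).1 hxw
        have hp : ⟨x, hxX⟩ ≠ p.1 := fun h => hx ((mem_support_left hXY he (x := ⟨x, hxX⟩)).2 h)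
        rcases (hG p q).1 hw with ⟨-, h⟩ | ⟨h, -⟩
        · exact ⟨⟨x, hxX⟩, by simpa [hq] using h, rfl⟩
        · exact (hp (hq.trans h.symm)).elim
      · rintro ⟨x, hx, rfl⟩
        have hx := GridOrientation.mem_outX.1 hx
        refine ⟨⟨fun h => ?_, e (x, p.2), (hG _ _).2 (.inl ⟨rfl, hx⟩),
          (mem_support_left hXY he).2 rfl⟩, x.2⟩
        rw [mem_support_left hXY he] at h
        exact G.hor_irrefl _ _ (by simpa [h] using hx)
    rw [EdgeOrientation.refinedOutDegree, this, ncard_image_of_injective _ Subtype.val_injective,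
      ncard_coe_finset]
  · have : O.outmap (e p) ∩ Y = Subtype.val '' (G.outY p : Set Y) := by
      ext y
      constructor
      · rintro ⟨⟨hy, w, hw, hyw⟩, hyY⟩
        obtain ⟨q, rfl⟩ := e.surjective w
        have hq := (mem_support_right hXY he (y := ⟨y, hyY⟩)).1 hyw
        have hp : ⟨y, hyY⟩ ≠ p.2 := fun h => hy ((mem_support_right hXY he (y := ⟨y, hyY⟩)).2 h)
        rcases (hG p q).1 hw with ⟨h, -⟩ | ⟨-, h⟩
        · exact (hp (hq.trans h.symm)).elim
        · exact ⟨⟨y, hyY⟩, by simpa [hq] using h, rfl⟩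
      · rintro ⟨y, hy, rfl⟩
        have hy := GridOrientation.mem_outY.1 hy
        refine ⟨⟨fun h => ?_, e (p.1, y), (hG _ _).2 (.inr ⟨rfl, hy⟩),
          (mem_support_right hXY he).2 rfl⟩, y.2⟩
        rw [mem_support_right hXY he] at h
        exact G.ver_irrefl _ _ (by simpa [h] using hy)
    rw [EdgeOrientation.refinedOutDegree, this, ncard_image_of_injective _ Subtype.val_injective,
      ncard_coe_finset]

end IsGridPartition

end HPolytope

/-! ### The random walk on the polytope -/

namespace HPolytope

open Relation

variable {d : ℕ} {H : Type*} [Fintype H] {P : HPolytope d H} {X Y : Set H}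

namespace EdgeOrientation

variable {O : P.EdgeOrientation}

lemma stepProb_ne_top (u w : P.Vertex) : O.stepProb u w ≠ ∞ := by
  classical
  rw [stepProb]
  split_ifs with h h'
  · have : {z | O.arc u z}.ncard ≠ 0 := (ncard_pos).2 h |>.ne'
    simpa using this
  · simp
  · simp
  · simp

variable {e : X × Y ≃ P.Vertex} {G : GridOrientation X Y}

lemma transGen_iff (hG : ∀ p q, O.arc (e p) (e q) ↔ G.Arc p q) (p q : X × Y) :
    TransGen O.arc (e p) (e q) ↔ TransGen G.Arc p q := by
  constructor
  · intro h
    have := TransGen.lift (p := G.Arc) e.symm (fun a b hab => ?_) _ _ h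
    · simpa [Function.onFun] using this
    · simp only [Function.onFun]
      rwa [← hG, e.apply_symm_apply, e.apply_symm_apply]
  · exact fun h => TransGen.lift e (fun a b hab => (hG a b).2 hab) _ _ h

variable [Fintype X] [Fintype Y] [Fintype P.Vertex]

open Classical in
lemma sum_stepProb_mul (hG : ∀ p q, O.arc (e p) (e q) ↔ G.Arc p q) {p : X × Y}
    (hp : 0 < (G.outX p).card + (G.outY p).card) (g : P.Vertex → ℝ≥0∞) :
    ∑ w, O.stepProb (e p) w * g w = (((G.outX p).card + (G.outY p).card : ℕ) : ℝ≥0∞)⁻¹ *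
      (∑ x ∈ G.outX p, g (e (x, p.2)) + ∑ y ∈ G.outY p, g (e (p.1, y))) := by
  have hcard : {z | O.arc (e p) z}.ncard = (G.outX p).card + (G.outY p).card := by
    have h₁ : {z | O.arc (e p) z} = e '' (({q | G.Arc p q} : Finset (X × Y)) : Set (X × Y)) := by
      ext z
      obtain ⟨q, rfl⟩ := e.surjective z
      simp [hG]
    rw [h₁, ncard_image_of_injective _ e.injective, ncard_coe_finset, Finset.card_eq_sum_ones,
      GridOrientation.sum_arc]
    simp
  have hex : ∃ z, O.arc (e p) z := by
    rw [← hcard] at hp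
    exact (ncard_pos).1 hp
  rw [← GridOrientation.sum_arc p fun q => g (e q), Finset.sum_filter, Finset.mul_sum,
    ← e.sum_comp]
  refine Finset.sum_congr rfl fun q _ => ?_
  rw [stepProb, if_pos hex, hcard]
  by_cases h : G.Arc p q
  · simp [hG, h]
  · simp [hG, h]

/-- First-step analysis expresses the time truncated at `t + 1` as one plus a mean of times
truncated at `t`; monotonicity in `t` lowers the left side. -/
lemma toReal_truncatedHittingTime_le (hG : ∀ p q, O.arc (e p) (e q) ↔ G.Arc p q) {W : Set P.Vertex}
    (t : ℕ) {p : X × Y} (hW : e p ∉ W) (hp : 0 < (G.outX p).card + (G.outY p).card) :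
    ((G.outX p).card + (G.outY p).card) * (truncatedHittingTime O.stepProb W t (e p)).toReal ≤
      ((G.outX p).card + (G.outY p).card) +
        ∑ x ∈ G.outX p, (truncatedHittingTime O.stepProb W t (e (x, p.2))).toReal +
        ∑ y ∈ G.outY p, (truncatedHittingTime O.stepProb W t (e (p.1, y))).toReal := by
  have hfin := truncatedHittingTime_ne_top (O.stepProb_ne_top) W t
  have h := truncatedHittingTime_le_succ O.stepProb W t (e p)
  rw [truncatedHittingTime, if_neg hW, sum_stepProb_mul hG hp] at h
  have hn : ((((G.outX p).card + (G.outY p).card : ℕ) : ℝ≥0∞)⁻¹) ≠ ∞ :=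
    ENNReal.inv_ne_top.2 (Nat.cast_ne_zero.2 hp.ne')
  have hs : (∑ x ∈ G.outX p, truncatedHittingTime O.stepProb W t (e (x, p.2)) +
      ∑ y ∈ G.outY p, truncatedHittingTime O.stepProb W t (e (p.1, y))) ≠ ∞ :=
    ENNReal.add_ne_top.2 ⟨ENNReal.sum_ne_top.2 fun _ _ => hfin _,
      ENNReal.sum_ne_top.2 fun _ _ => hfin _⟩
  have h' := ENNReal.toReal_mono (ENNReal.add_ne_top.2 ⟨by simp, ENNReal.mul_ne_top hn hs⟩) h
  rw [ENNReal.toReal_add (by simp) (ENNReal.mul_ne_top hn hs), ENNReal.toReal_mul,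
    ENNReal.toReal_add (ENNReal.sum_ne_top.2 fun _ _ => hfin _)
      (ENNReal.sum_ne_top.2 fun _ _ => hfin _), ENNReal.toReal_sum fun _ _ => hfin _,
    ENNReal.toReal_sum fun _ _ => hfin _, ENNReal.toReal_inv, ENNReal.toReal_natCast,
    ENNReal.toReal_one] at h'
  have hpos : (0 : ℝ) < ((G.outX p).card : ℝ) + (G.outY p).card := by exact_mod_cast hp
  push_cast at h'
  have h₁ := mul_le_mul_of_nonneg_left h' hpos.le
  rw [mul_add, mul_one, mul_inv_cancel_left₀ hpos.ne'] at h₁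
  linarith

end EdgeOrientation

namespace IsGridPartition

variable {O : P.EdgeOrientation}

lemma card_add_card (hXY : P.IsGridPartition X Y) [Fintype X] [Fintype Y] :
    Fintype.card X + Fintype.card Y = Fintype.card H := by
  have h := ncard_add_ncard_compl X
  rw [hXY.1.compl_eq, Nat.card_eq_fintype_card] at h
  rwa [← Nat.card_coe_set_eq, ← Nat.card_coe_set_eq, Nat.card_eq_fintype_card,
    Nat.card_eq_fintype_card] at h

/-- The milestone vertices exist and are unique. -/
theorem existsUnique_isMilestoneVertex (hXY : P.IsGridPartition X Y) (hO : O.IsUniqueSink) {i : ℕ}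
    (hi : i ≤ numMilestones X Y) : ∃! w, O.IsMilestoneVertex X Y i w := by
  classical
  obtain ⟨e, he⟩ := hXY.exists_equiv
  obtain ⟨G, hG⟩ := hXY.exists_gridOrientation he hO
  have := Fintype.ofFinite X
  have := Fintype.ofFinite Y
  have hX : Fintype.card X = X.ncard := by rw [← Nat.card_coe_set_eq, Nat.card_eq_fintype_card]
  have hY : Fintype.card Y = Y.ncard := by rw [← Nat.card_coe_set_eq, Nat.card_eq_fintype_card]
  have h2X := hXY.two_le_ncard
  have h2Y := hXY.symm.two_le_ncard
  have key : ∀ m, m < X.ncard → m < Y.ncard → ∃! w, O.refinedOutDegree X Y w = (m, m) := by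
    intro m hmX hmY
    obtain ⟨p, hpX, hpY⟩ := GridOrientation.exists_degrees (G := G) (hX ▸ hmX) (hY ▸ hmY)
    refine ⟨e p, ?_, fun w hw => ?_⟩
    · simp only [hXY.refinedOutDegree_eq he hG, hpX, hpY]
    · obtain ⟨q, rfl⟩ := e.surjective w
      rw [hXY.refinedOutDegree_eq he hG, Prod.mk.injEq] at hw
      exact congrArg e (GridOrientation.degrees_injective (hw.1.trans hpX.symm)
        (hw.2.trans hpY.symm))
  cases i with
  | zero => exact key 0 (by omega) (by omega)
  | succ j =>
    -- This is where the value of `numMilestones` matters: the degree pair has to be in range.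
    have hj : 2 ^ j ≤ min (X.ncard - 1) (Y.ncard - 1) := by
      refine (Nat.pow_le_pow_right two_pos ?_).trans (Nat.pow_log_le_self 2 (by omega))
      rw [numMilestones] at hi
      omega
    exact key (2 ^ j) (by omega) (by omega)

/-- The expected time that the directed random walk takes from one milestone to the next. -/
theorem lintegral_walkHittingTime_milestone_le (hXY : P.IsGridPartition X Y)
    (hO : O.IsUniqueSink) {i : ℕ} {w w' v₀ : P.Vertex} (hw : O.IsMilestoneVertex X Y i w)
    (hw' : O.IsMilestoneVertex X Y (i + 1) w') (hv₀ : v₀ ∈ O.milestone (i + 1) w') {Ω : Type*}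
    [MeasurableSpace Ω] {μ : Measure Ω} {v : ℕ → Ω → P.Vertex} (hv : O.IsRandomWalk μ v₀ v) :
    ∫⁻ ω, walkHittingTime v (O.milestone i w) ω ∂μ ≤
      ENNReal.ofReal (155 * ((harmonic (Fintype.card H) : ℝ) + 1)) := by
  classical
  obtain ⟨e, he⟩ := hXY.exists_equiv
  obtain ⟨G, hG⟩ := hXY.exists_gridOrientation he hO
  have := Fintype.ofFinite X
  have := Fintype.ofFinite Y
  have := Fintype.ofFinite P.Vertex
  have := hv.isProbabilityMeasure
  refine lintegral_walkHittingTime_le hv.measurableSet_eq hv.start hv.step fun t => ?_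
  have hfin := truncatedHittingTime_ne_top (O.stepProb_ne_top) (O.milestone i w) t
  rw [← ENNReal.ofReal_toReal (hfin v₀)]
  refine ENNReal.ofReal_le_ofReal ?_
  obtain ⟨p, rfl⟩ := e.surjective w
  obtain ⟨p', rfl⟩ := e.surjective w'
  obtain ⟨p₀, rfl⟩ := e.surjective v₀
  have hreach : TransGen G.Arc p' p₀ := (EdgeOrientation.transGen_iff hG _ _).1 hv₀
  rw [← hXY.card_add_card]
  simp only [EdgeOrientation.IsMilestoneVertex, hXY.refinedOutDegree_eq he hG,
    Prod.mk.injEq] at hw'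
  cases i with
  | zero =>
    simp only [EdgeOrientation.IsMilestoneVertex, hXY.refinedOutDegree_eq he hG,
      Prod.mk.injEq, Finset.card_eq_zero] at hw
    refine GridOrientation.le_harmonic_of_sink (p := p)
      (h := fun q => (truncatedHittingTime O.stepProb _ t (e q)).toReal) hw.1 hw.2
      (by simpa using hw'.1) (by simpa using hw'.2) (fun q => ENNReal.toReal_nonneg) ?_ ?_ hreach
    · rw [truncatedHittingTime_of_mem (show e p ∈ O.milestone 0 (e p) from rfl),
        ENNReal.toReal_zero]
    · refine fun q hq hpos => EdgeOrientation.toReal_truncatedHittingTime_le hG t ?_ hpos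
      exact fun h => hq (e.injective h)
  | succ j =>
    simp only [EdgeOrientation.IsMilestoneVertex, hXY.refinedOutDegree_eq he hG,
      Prod.mk.injEq] at hw
    have hmem : ∀ q, e q ∈ O.milestone (j + 1) (e p) ↔ TransGen G.Arc p q :=
      fun q => EdgeOrientation.transGen_iff hG _ _
    refine GridOrientation.le_harmonic_of_transGen (p := p) (k := 2 ^ j)
      (h := fun q => (truncatedHittingTime O.stepProb _ t (e q)).toReal) Nat.one_le_two_pow
      hw.1 hw.2 (by rw [hw'.1, pow_succ']) (by rw [hw'.2, pow_succ'])
      (fun q => ENNReal.toReal_nonneg) ?_ ?_ hreach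
    · intro q hq
      rw [truncatedHittingTime_of_mem ((hmem q).2 hq), ENNReal.toReal_zero]
    · refine fun q hq hpos => EdgeOrientation.toReal_truncatedHittingTime_le hG t ?_ hpos
      exact fun h => hq ((hmem q).1 h)

end IsGridPartition

end HPolytope

lemma harmonic_isBigO_log :
    (fun n : ℕ => 155 * ((harmonic n : ℝ) + 1)) =O[Filter.atTop] fun n : ℕ => Real.log n := by
  -- Here `465 = 3 * 155`: for `n ≥ 3` the logarithm is at least one, so `harmonic n + 1 ≤ 2 + log n
  -- ≤ 3 * log n`.
  refine Asymptotics.IsBigO.of_bound 465 ?_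
  filter_upwards [Filter.eventually_ge_atTop 3] with n hn
  have hn' : (3 : ℝ) ≤ n := by exact_mod_cast hn
  have hlog : 1 ≤ Real.log n := by
    rw [Real.le_log_iff_exp_le (by linarith)]
    exact (Real.exp_one_lt_three.trans_le hn').le
  have h₁ := harmonic_le_one_add_log n
  have h₂ := one_le_cast_harmonic (show 1 ≤ n by omega)
  rw [Real.norm_of_nonneg (by linarith), Real.norm_of_nonneg (by linarith)]
  linarith

theorem proposition2 :
    (∀ (d : ℕ) (H : Type*) [Fintype H] (P : HPolytope d H) (O : P.EdgeOrientation),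
      Fintype.card H = d + 2 → P.IsSimple → O.IsUniqueSink →
      (∃ X Y : Set H, P.IsGridPartition X Y) ∧
      ∀ X Y : Set H, P.IsGridPartition X Y →
        (∀ i ≤ numMilestones X Y, ∃! w, O.IsMilestoneVertex X Y i w) ∧
        ∀ i < numMilestones X Y, ∀ w w' : P.Vertex,
          O.IsMilestoneVertex X Y i w → O.IsMilestoneVertex X Y (i + 1) w' →
          ∀ v₀ ∈ O.milestone (i + 1) w',
          ∀ (Ω : Type*) [MeasurableSpace Ω] (μ : Measure Ω) (v : ℕ → Ω → P.Vertex),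
            O.IsRandomWalk μ v₀ v →
            ∫⁻ ω, walkHittingTime v (O.milestone i w) ω ∂μ ≤
              ENNReal.ofReal (155 * ((harmonic (Fintype.card H) : ℝ) + 1))) ∧
    (fun n : ℕ => 155 * ((harmonic n : ℝ) + 1)) =O[Filter.atTop] fun n : ℕ => Real.log n := by
  refine ⟨?_, harmonic_isBigO_log⟩
  intro d H _ P O hcard hP hO
  refine ⟨HPolytope.exists_isGridPartition hcard hP, fun X Y hXY => ⟨fun i hi => ?_, ?_⟩⟩
  · exact hXY.existsUnique_isMilestoneVertex hO hi
  · intro i _ w w' hw hw' v₀ hv₀ Ω _ μ v hv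
    exact hXY.lintegral_walkHittingTime_milestone_le hO hw hw' hv₀ hv
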